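/- Let $n\ge 1$, let $f:\mathbb R^n\to\mathbb R$ be differentiable with $L$-Lipschitz gradient with respect to the Euclidean norm ($L\ge 0$), let $\mu\in\mathbb R^n$, $\tau\in\mathbb R$ with $f(\mu)\neq\tau$, and $\delta\in(0,1)$. The function $f$ and $L,\tau,\delta$ are known and $\mu$ is unknown. Every pull of arm $i\in\{1,\dots,n\}$ returns $\mu_i$ plus fresh standard normal noise; the noise variables of all pulls are independent. Consider the following algorithm. In round $r=1,2,\dots$, with $B_r=n2^r$ and $\tilde B_r=\sum_{\ell=1}^r\lceil B_\ell/n\rceil$: 1. Pull each arm $\lceil B_r/n\rceil$ times, and let $\hat\mu^{(r)}_i$ be the average of the $\tilde B_r$ observations of arm $i$ from this step in rounds $1,\dots,r$. 2. With $C_r=\sqrt{2\log(12nr^2/\delta)/\tilde B_r}$, let $\hat g^{(r,L)}_i$ and $\hat g^{(r,U)}_i$ be the minimum and the maximum of $|\partial_i f(y)|$ over $\{y:\|y-\hat\mu^{(r)}\|_\infty\le C_r\}$, and let $\alpha^{(r)}$ be the probability vector proportional to $(\hat g^{(r,L)}_i)_i$ (uniform if all of these vanish). 3. Pull each arm $i$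 a further $\tilde T_i^{(r)}=\lceil(\alpha_i^{(r)}+\frac1n)B_r\rceil$ times, and let $\tilde\mu^{(r)}_i$ be the average of these $\tilde T_i^{(r)}$ observations. 4. Put $C^f_r=\sqrt{2\log(24r^2/\delta)\sum_i(\hat g_i^{(r,U)})^2/\tilde T_i^{(r)}}+Ln\log(24nr^2/\delta)/\tilde B_r$. If $C_r^f\le|f(\tilde\mu^{(r)})-\tau|$, stop and output whether $f(\tilde\mu^{(r)})>\tau$; otherwise go on to round $r+1$. There is a universal constant $C>0$ such that, for all such $n,f,L,\mu,\tau,\delta$, with probability at least $1-\delta$ the algorithm terminates, its output correctly states whether $f(\mu)>\tau$, and the total number of pulls it makes is at most $$C\left(n+\left(\frac{\|\nabla f(\mu)\|_1^2\log(2/\delta)}{(f(\mu)-\tau)^2}+\frac{n^2L\log(2n/\delta)}{|f(\mu)-\tau|}\right)\log\log\left(16+n+\frac1\delta+\|\nabla f(\mu)\|_1+L+\frac1{|f(\mu)-\tau|}\right)\right).$$ -/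

import Mathlib

namespace AdaptiveThresholding

noncomputable section

/-- The two batches of pulls made in every round: first every arm is pulled equally often
(`uniform`), then the arms are pulled according to the estimated sampling frequencies
(`weighted`). -/
inductive Phase where
  | uniform
  | weighted

/-- `Pull n` labels the individual pulls: `(i, r, p, k)` is the `k`-th pull (counted from `0`)
of arm `i` in the batch `p` of round `r`. Different pulls have different labels, and each pull
returns its own fresh observation. -/
abbrev Pull (n : ℕ) : Type := Fin n × ℕ × Phase × ℕ

/-- The round budget `B_r = n 2 ^ r`. -/
def roundBudget (n r : ℕ) : ℕ := n * 2 ^ r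

/-- The number `⌈B_r / n⌉` of uniform pulls of each arm in round `r`. -/
def uniformPulls (n r : ℕ) : ℕ := ⌈(roundBudget n r : ℝ) / n⌉₊

/-- The number `∑_{ℓ = 1}^r ⌈B_ℓ / n⌉` of uniform pulls of each arm in rounds `1, …, r`. -/
def cumUniformPulls (n r : ℕ) : ℕ := ∑ l ∈ Finset.Icc 1 r, uniformPulls n l

/-- The estimate of the mean vector by the averages of all uniform pulls in rounds
`1, …, r`. -/
def muHat {n : ℕ} (X : Pull n → ℝ) (r : ℕ) : EuclideanSpace ℝ (Fin n) :=
  WithLp.toLp 2 fun i =>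
    (∑ l ∈ Finset.Icc 1 r, ∑ k ∈ Finset.range (uniformPulls n l), X (i, l, Phase.uniform, k)) /
      (cumUniformPulls n r : ℝ)

/-- The width `C_r` of the confidence intervals for the coordinates of `muHat X r`. -/
def confWidth (n : ℕ) (δ : ℝ) (r : ℕ) : ℝ :=
  √(2 * Real.log (12 * n * (r : ℝ) ^ 2 / δ) / cumUniformPulls n r)

/-- The closed ball of radius `c` around `x` in the supremum norm. -/
def box {n : ℕ} (x : EuclideanSpace ℝ (Fin n)) (c : ℝ) : Set (EuclideanSpace ℝ (Fin n)) :=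
  {y | ∀ i, |y i - x i| ≤ c}

/-- The minimum of `|∂f/∂x_i|` over the confidence box around `muHat X r`. -/
def gradLower {n : ℕ} (f : EuclideanSpace ℝ (Fin n) → ℝ) (δ : ℝ) (X : Pull n → ℝ) (r : ℕ)
    (i : Fin n) : ℝ :=
  sInf ((fun y => |gradient f y i|) '' box (muHat X r) (confWidth n δ r))

/-- The maximum of `|∂f/∂x_i|` over the confidence box around `muHat X r`. -/
def gradUpper {n : ℕ} (f : EuclideanSpace ℝ (Fin n) → ℝ) (δ : ℝ) (X : Pull n → ℝ) (r : ℕ)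
    (i : Fin n) : ℝ :=
  sSup ((fun y => |gradient f y i|) '' box (muHat X r) (confWidth n δ r))

open Classical in
/-- The sampling frequencies: the point of the probability simplex proportional to the lower
gradient bounds, and the uniform distribution if these bounds all vanish. -/
def samplingFreq {n : ℕ} (f : EuclideanSpace ℝ (Fin n) → ℝ) (δ : ℝ) (X : Pull n → ℝ) (r : ℕ)
    (i : Fin n) : ℝ :=
  if ∑ j, gradLower f δ X r j = 0 then 1 / (n : ℝ)
  else gradLower f δ X r i / ∑ j, gradLower f δ X r j

/-- The number `⌈(α_i + 1 / n) B_r⌉` of weighted pulls of arm `i` in round `r`. -/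
def weightedPulls {n : ℕ} (f : EuclideanSpace ℝ (Fin n) → ℝ) (δ : ℝ) (X : Pull n → ℝ) (r : ℕ)
    (i : Fin n) : ℕ :=
  ⌈(samplingFreq f δ X r i + 1 / (n : ℝ)) * roundBudget n r⌉₊

/-- The estimate of the mean vector by the averages of the weighted pulls of round `r`. -/
def muTilde {n : ℕ} (f : EuclideanSpace ℝ (Fin n) → ℝ) (δ : ℝ) (X : Pull n → ℝ) (r : ℕ) :
    EuclideanSpace ℝ (Fin n) :=
  WithLp.toLp 2 fun i =>
    (∑ k ∈ Finset.range (weightedPulls f δ X r i), X (i, r, Phase.weighted, k)) /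
      (weightedPulls f δ X r i : ℝ)

/-- The confidence width `C^f_r` for `f (muTilde f δ X r)`: a first order term plus a second
order term. -/
def funConfWidth {n : ℕ} (f : EuclideanSpace ℝ (Fin n) → ℝ) (L δ : ℝ) (X : Pull n → ℝ)
    (r : ℕ) : ℝ :=
  √(2 * Real.log (24 * (r : ℝ) ^ 2 / δ) *
      ∑ i, gradUpper f δ X r i ^ 2 / (weightedPulls f δ X r i : ℝ)) +
    L * n * Real.log (24 * n * (r : ℝ) ^ 2 / δ) / cumUniformPulls n r

/-- The stopping condition checked at the end of round `r`. -/
def StopCondition {n : ℕ} (f : EuclideanSpace ℝ (Fin n) → ℝ) (L τ δ : ℝ) (X : Pull n → ℝ)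
    (r : ℕ) : Prop :=
  funConfWidth f L δ X r ≤ |f (muTilde f δ X r) - τ|

/-- The number of arm pulls, of both kinds, made in rounds `1, …, r`. -/
def pullsThrough {n : ℕ} (f : EuclideanSpace ℝ (Fin n) → ℝ) (δ : ℝ) (X : Pull n → ℝ)
    (r : ℕ) : ℕ :=
  ∑ l ∈ Finset.Icc 1 r, ∑ i, (uniformPulls n l + weightedPulls f δ X l i)

/-- On the observations `X`, the adaptive thresholding algorithm with inputs `f`, `L`, `τ`, `δ`
terminates, returns `answer` and has made exactly `T` arm pulls: `r ≥ 1` is the first round whose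
stopping condition holds, and `answer` is the truth value of `f (muTilde f δ X r) > τ`. -/
def Returns {n : ℕ} (f : EuclideanSpace ℝ (Fin n) → ℝ) (L τ δ : ℝ) (X : Pull n → ℝ)
    (answer : Bool) (T : ℕ) : Prop :=
  ∃ r : ℕ, 1 ≤ r ∧ StopCondition f L τ δ X r ∧
    (∀ s : ℕ, 1 ≤ s → s < r → ¬ StopCondition f L τ δ X s) ∧
    (answer = true ↔ f (muTilde f δ X r) > τ) ∧
    T = pullsThrough f δ X r

/-- The `ℓ¹` norm of the gradient of `f` at `x`. -/
def gradL1 {n : ℕ} (f : EuclideanSpace ℝ (Fin n) → ℝ) (x : EuclideanSpace ℝ (Fin n)) : ℝ :=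
  ∑ i, |gradient f x i|

end

end AdaptiveThresholding

namespace AdaptiveThresholding

open MeasureTheory ProbabilityTheory
open scoped ENNReal NNReal

/-! ### Gaussian tail bounds -/

/-! Everything is deterministic on the event that `BoundsHold` in every round. In round `r` three
bounds fail with probability at most `δ/(6r²)`, `δ/(12r²)` and `δ/(12r²)`: the box around `muHat`
contains `μ`; the linear form `⟨∇f(μ), muTilde - μ⟩` obeys its Gaussian tail bound; and `‖muTilde -
μ‖²` is small. Summing over `r` gives at most `δ`. The weighted sample sizes are random but depend
only on uniform pulls, so conditioning on them leaves the weighted noise Gaussian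
(`measure_weightedPulls_mem_le`).

The quadratic bound is the delicate one. The width divides by `cumUniformPulls`, about `2 * 2^r`,
while an arm may get only about `2^r` weighted pulls, so a union bound over single coordinates loses
a factor 2. It is regained by pairing coordinates cyclically: for independent standard normals `Y`,
`Y'` the event `Y² + Y'² > 2s` has probability exactly `exp (-s)`, so a pair costs no more than one
coordinate would (`measure_quadratic_term_gt_le`).

On the good event, a Taylor estimate gives `|f(muTilde) - f(μ)| ≤ funConfWidth`, so any stop is
correct. With `Δ = |f(μ) - τ|`, a width of at most `Δ/2` forces a stop. Sampling proportionally to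
the lower gradient bounds makes the first-order variance about `‖∇f(μ)‖₁² / (n 2^r)`, up to an error
of order `(nL/2^r)²` times a logarithm. Hence a round that fails to stop has `n 2^r ≲ M (1 + log
r)`, where `M` is the bracketed complexity; so `r = O(log K)` with `K` the argument of the iterated
logarithm, and `log r` becomes `log log K`. Budgets double, so the last round dominates the cost. -/

theorem hasLaw_sum_const_mul {Ω β : Type*} [MeasurableSpace Ω] {P : Measure Ω}
    [IsProbabilityMeasure P] {W : β → Ω → ℝ} (hm : ∀ b, Measurable (W b))
    (hW : ∀ b, HasLaw (W b) (gaussianReal 0 1) P) (hi : iIndepFun W P) (c : β → ℝ)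
    (S : Finset β) :
    HasLaw (fun ω => ∑ b ∈ S, c b * W b ω)
      (gaussianReal 0 (∑ b ∈ S, ‖c b‖₊ ^ 2)) P := by
  classical
  induction S using Finset.induction_on with
  | empty =>
    simp only [Finset.sum_empty, gaussianReal_zero_var]
    exact ⟨by fun_prop, by simp⟩
  | insert a S ha ih =>
    have h1 : HasLaw (fun ω => c a * W a ω) (gaussianReal 0 (‖c a‖₊ ^ 2)) P := by
      have := gaussianReal_const_mul (hW a) (c a)
      convert this using 2
      · simp
      · ext; simp
    have hind : iIndepFun (fun b ω => c b * W b ω) P :=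
      hi.comp (fun b x => c b * x) (fun b => by fun_prop)
    have h2 : IndepFun (∑ b ∈ S, fun ω => c b * W b ω) (fun ω => c a * W a ω) P :=
      hind.indepFun_finsetSum_of_notMem (fun b => (hm b).const_mul _) ha
    have e : (∑ b ∈ S, fun ω => c b * W b ω) = fun ω => ∑ b ∈ S, c b * W b ω := by
      ext ω; simp
    rw [e] at h2
    have h3 := gaussianReal_add_gaussianReal_of_indepFun h2.symm h1.map_eq ih.map_eq
    refine ⟨?_, ?_⟩
    · exact (Finset.measurable_fun_sum _ fun b _ => (hm b).const_mul _).aemeasurable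
    · rw [Finset.sum_insert ha]
      convert h3 using 2
      · ext ω; simp [Finset.sum_insert ha]
      · simp

theorem hasSubgaussianMGF_of_hasLaw {Ω : Type*} [MeasurableSpace Ω] {P : Measure Ω}
    {Y : Ω → ℝ} {v : ℝ≥0} (hY : HasLaw Y (gaussianReal 0 v) P) : HasSubgaussianMGF Y v P where
  integrable_exp_mul t := by
    have := integrable_exp_mul_gaussianReal (μ := 0) (v := v) t
    rw [← hY.map_eq] at this
    exact this.comp_aemeasurable hY.aemeasurable
  mgf_le t := by rw [mgf_gaussianReal hY.map_eq]; simp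

theorem measure_abs_gt_le_of_hasLaw {Ω : Type*} [MeasurableSpace Ω] {P : Measure Ω}
    [IsProbabilityMeasure P] {Y : Ω → ℝ} {v : ℝ≥0} (hY : HasLaw Y (gaussianReal 0 v) P)
    {t : ℝ} (ht : 0 ≤ t) :
    P {ω | √(2 * t * v) < |Y ω|} ≤ ENNReal.ofReal (2 * Real.exp (-t)) := by
  have hs := hasSubgaussianMGF_of_hasLaw hY
  -- The Chernoff exponent divides by `v`, so the degenerate law is treated apart.
  rcases eq_or_ne v 0 with rfl | hv
  · have h0 := hs.ae_eq_zero_of_hasSubgaussianMGF_zero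
    have : P {ω | √(2 * t * (0 : ℝ≥0)) < |Y ω|} = 0 := by
      refine measure_mono_null (t := {ω | ¬ Y ω = (0 : Ω → ℝ) ω}) ?_ (ae_iff.1 h0)
      intro ω hω h
      have hω' : √(2 * t * (0 : ℝ≥0)) < |Y ω| := hω
      simp [show Y ω = 0 from h] at hω'
    rw [this]; exact zero_le
  have hv' : (0 : ℝ) < v := by positivity
  have key : ∀ {Y' : Ω → ℝ}, HasSubgaussianMGF Y' v P →
      P {ω | √(2 * t * v) ≤ Y' ω} ≤ ENNReal.ofReal (Real.exp (-t)) := by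
    intro Y' h
    have := h.measure_ge_le (Real.sqrt_nonneg (2 * t * v))
    rw [Real.sq_sqrt (by positivity)] at this
    have e : -(2 * t * (v : ℝ)) / (2 * v) = -t := by field_simp
    rw [e] at this
    rw [← ofReal_measureReal]
    exact ENNReal.ofReal_le_ofReal this
  calc P {ω | √(2 * t * v) < |Y ω|}
      ≤ P ({ω | √(2 * t * v) ≤ Y ω} ∪ {ω | √(2 * t * v) ≤ (-Y) ω}) := by
        refine measure_mono fun ω hω => ?_
        rcases lt_abs.1 (show _ < |Y ω| from hω) with h | h
        · exact Or.inl h.le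
        · exact Or.inr h.le
    _ ≤ _ := measure_union_le _ _
    _ ≤ ENNReal.ofReal (Real.exp (-t)) + ENNReal.ofReal (Real.exp (-t)) :=
        add_le_add (key hs) (key hs.neg)
    _ = ENNReal.ofReal (2 * Real.exp (-t)) := by
        rw [← ENNReal.ofReal_add (Real.exp_pos _).le (Real.exp_pos _).le, two_mul]

/-! ### Exact tail of the radius of a planar Gaussian -/

theorem lintegral_Ioi_mul_exp_neg_sq_div_two (a : ℝ) (ha : 0 ≤ a) :
    ∫⁻ r in Set.Ioi a, ENNReal.ofReal (r * Real.exp (-r ^ 2 / 2)) =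
      ENNReal.ofReal (Real.exp (-a ^ 2 / 2)) := by
  have hd : ∀ x ∈ Set.Ici a,
      HasDerivAt (fun r : ℝ => -Real.exp (-r ^ 2 / 2)) (x * Real.exp (-x ^ 2 / 2)) x := by
    intro x _
    have h : HasDerivAt (fun r : ℝ => -r ^ 2 / 2) (-x) x := by
      refine (((hasDerivAt_pow 2 x).neg).div_const 2).congr_deriv ?_
      push_cast; ring
    exact h.exp.neg.congr_deriv (by ring)
  have hpos : ∀ x ∈ Set.Ioi a, 0 ≤ x * Real.exp (-x ^ 2 / 2) := fun x hx =>
    mul_nonneg (ha.trans (le_of_lt hx)) (Real.exp_pos _).le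
  have hlim : Filter.Tendsto (fun r : ℝ => -Real.exp (-r ^ 2 / 2)) Filter.atTop (nhds 0) := by
    rw [← neg_zero]
    refine (Real.tendsto_exp_atBot.comp ?_).neg
    have h2 : Filter.Tendsto (fun r : ℝ => r ^ 2 / 2) Filter.atTop Filter.atTop :=
      (Filter.tendsto_pow_atTop two_ne_zero).atTop_div_const two_pos
    refine (Filter.tendsto_neg_atTop_atBot.comp h2).congr fun r => ?_
    simp [neg_div]
  have hint := integrableOn_Ioi_deriv_of_nonneg' hd hpos hlim
  rw [← ofReal_integral_eq_lintegral_ofReal hint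
    ((ae_restrict_iff' measurableSet_Ioi).2 (ae_of_all _ hpos)),
    integral_Ioi_of_hasDerivAt_of_nonneg' hd hpos hlim]
  simp

/-- In polar coordinates the density becomes `r * exp (-r²/2) / (2π)`, which has an elementary
antiderivative in `r`. Having no prefactor in the tail is what makes pairing coordinates profitable.
-/
theorem gaussianReal_prod_sq_add_sq_gt {s : ℝ} (hs : 0 ≤ s) :
    ((gaussianReal 0 1).prod (gaussianReal 0 1)) {p : ℝ × ℝ | 2 * s < p.1 ^ 2 + p.2 ^ 2} =
      ENNReal.ofReal (Real.exp (-s)) := by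
  have hA : MeasurableSet {p : ℝ × ℝ | 2 * s < p.1 ^ 2 + p.2 ^ 2} :=
    measurableSet_lt (by fun_prop) (by fun_prop)
  rw [gaussianReal_of_var_ne_zero _ one_ne_zero,
    prod_withDensity (measurable_gaussianPDF _ _) (measurable_gaussianPDF _ _),
    withDensity_apply _ hA, ← lintegral_indicator hA, ← Measure.volume_eq_prod,
    ← lintegral_comp_polarCoord_symm]
  have h1 : ∀ p ∈ polarCoord.target, ENNReal.ofReal p.1 •
      ({p : ℝ × ℝ | 2 * s < p.1 ^ 2 + p.2 ^ 2}.indicator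
        (fun z => gaussianPDF 0 1 z.1 * gaussianPDF 0 1 z.2) (polarCoord.symm p)) =
      (Set.Ioi √(2 * s)).indicator
        (fun r => ENNReal.ofReal (r * Real.exp (-r ^ 2 / 2))) p.1 *
          ENNReal.ofReal (2 * Real.pi)⁻¹ := by
    intro p hp
    have hp1 : 0 < p.1 := hp.1
    have hsq : (p.1 * Real.cos p.2) ^ 2 + (p.1 * Real.sin p.2) ^ 2 = p.1 ^ 2 := by
      linear_combination p.1 ^ 2 * Real.sin_sq_add_cos_sq p.2
    have hmem : (polarCoord.symm p ∈ {p : ℝ × ℝ | 2 * s < p.1 ^ 2 + p.2 ^ 2}) ↔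
        p.1 ∈ Set.Ioi √(2 * s) := by
      simp only [polarCoord_symm_apply, Set.mem_ofPred_eq, Set.mem_Ioi, hsq]
      rw [Real.sqrt_lt' hp1]
    by_cases h : p.1 ∈ Set.Ioi √(2 * s)
    · rw [Set.indicator_of_mem (hmem.2 h), Set.indicator_of_mem h]
      simp only [gaussianPDF, smul_eq_mul, polarCoord_symm_apply]
      rw [← ENNReal.ofReal_mul (gaussianPDFReal_nonneg _ _ _), ← ENNReal.ofReal_mul hp1.le,
        ← ENNReal.ofReal_mul (by positivity)]
      congr 1
      simp only [gaussianPDFReal, NNReal.coe_one, mul_one, sub_zero]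
      have e1 : (√(2 * Real.pi))⁻¹ * (√(2 * Real.pi))⁻¹ = (2 * Real.pi)⁻¹ := by
        rw [← mul_inv, Real.mul_self_sqrt (by positivity)]
      have e2 : Real.exp (-(p.1 * Real.cos p.2) ^ 2 / 2) *
          Real.exp (-(p.1 * Real.sin p.2) ^ 2 / 2) = Real.exp (-p.1 ^ 2 / 2) := by
        rw [← Real.exp_add]; congr 1; linear_combination -hsq / 2
      rw [← e1, ← e2]; ring
    · rw [Set.indicator_of_notMem (fun h' => h (hmem.1 h')), Set.indicator_of_notMem h]
      simp
  rw [setLIntegral_congr_fun polarCoord.open_target.measurableSet h1]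
  have ht : polarCoord.target = Set.Ioi (0 : ℝ) ×ˢ Set.Ioo (-Real.pi) Real.pi := rfl
  rw [ht, Measure.volume_eq_prod, ← Measure.prod_restrict]
  rw [lintegral_prod_mul (f := (Set.Ioi √(2 * s)).indicator
        (fun r => ENNReal.ofReal (r * Real.exp (-r ^ 2 / 2))))
      (g := fun _ => ENNReal.ofReal (2 * Real.pi)⁻¹)
      ((Measurable.indicator (by fun_prop) measurableSet_Ioi).aemeasurable) (by fun_prop)]
  rw [lintegral_indicator measurableSet_Ioi, Measure.restrict_restrict measurableSet_Ioi,
    Set.Ioi_inter_Ioi, sup_of_le_left (Real.sqrt_nonneg _),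
    lintegral_Ioi_mul_exp_neg_sq_div_two _ (Real.sqrt_nonneg _), Real.sq_sqrt (by positivity)]
  rw [lintegral_const, Measure.restrict_apply MeasurableSet.univ, Set.univ_inter,
    Real.volume_Ioo, ← ENNReal.ofReal_mul (by positivity), ← ENNReal.ofReal_mul (by positivity)]
  congr 1
  have := Real.pi_ne_zero
  field_simp
  ring_nf

theorem measure_sq_add_sq_gt_of_indepFun {Ω : Type*} [MeasurableSpace Ω] {P : Measure Ω}
    [IsProbabilityMeasure P] {X Y : Ω → ℝ} (hX : HasLaw X (gaussianReal 0 1) P)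
    (hY : HasLaw Y (gaussianReal 0 1) P) (hXY : IndepFun X Y P) {s : ℝ} (hs : 0 ≤ s) :
    P {ω | 2 * s < X ω ^ 2 + Y ω ^ 2} = ENNReal.ofReal (Real.exp (-s)) := by
  have hlaw : HasLaw (fun ω => (X ω, Y ω)) ((gaussianReal 0 1).prod (gaussianReal 0 1)) P :=
    ⟨hX.aemeasurable.prodMk hY.aemeasurable, by
      rw [(indepFun_iff_map_prod_eq_prod_map_map hX.aemeasurable hY.aemeasurable).1 hXY,
        hX.map_eq, hY.map_eq]⟩
  rw [← gaussianReal_prod_sq_add_sq_gt hs]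
  exact hlaw.measure_eq (p := fun p : ℝ × ℝ => 2 * s < p.1 ^ 2 + p.2 ^ 2)
    (measurableSet_lt (by fun_prop) (by fun_prop))

theorem measure_abs_sum_gt_le {Ω β : Type*} [MeasurableSpace Ω] {P : Measure Ω}
    [IsProbabilityMeasure P] {W : β → Ω → ℝ} (hm : ∀ b, Measurable (W b))
    (hW : ∀ b, HasLaw (W b) (gaussianReal 0 1) P) (hi : iIndepFun W P) (c : β → ℝ)
    (S : Finset β) {t : ℝ} (ht : 0 ≤ t) :
    P {ω | √(2 * t * ∑ b ∈ S, c b ^ 2) < |∑ b ∈ S, c b * W b ω|} ≤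
      ENNReal.ofReal (2 * Real.exp (-t)) := by
  have := measure_abs_gt_le_of_hasLaw (hasLaw_sum_const_mul hm hW hi c S) ht
  simpa using this

/-- The normalisations `hc` and `hd` make both block sums standard normal; disjoint blocks make them
independent. -/
theorem measure_sum_sq_add_sum_sq_gt_le {Ω β : Type*} [MeasurableSpace Ω] {P : Measure Ω}
    [IsProbabilityMeasure P] {W : β → Ω → ℝ} (hm : ∀ b, Measurable (W b))
    (hW : ∀ b, HasLaw (W b) (gaussianReal 0 1) P) (hi : iIndepFun W P) {S T : Finset β}
    (hST : Disjoint S T) {c d : ℝ} (hc : (S.card : ℝ) * c ^ 2 = 1)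
    (hd : (T.card : ℝ) * d ^ 2 = 1) {s : ℝ} (hs : 0 ≤ s) :
    P {ω | 2 * s < (∑ b ∈ S, c * W b ω) ^ 2 + (∑ b ∈ T, d * W b ω) ^ 2} ≤
      ENNReal.ofReal (Real.exp (-s)) := by
  have law : ∀ (S : Finset β) (c : ℝ), (S.card : ℝ) * c ^ 2 = 1 →
      HasLaw (fun ω => ∑ b ∈ S, c * W b ω) (gaussianReal 0 1) P := by
    intro S c hc
    have := hasLaw_sum_const_mul hm hW hi (fun _ => c) S
    convert this using 2
    ext
    simpa using hc.symm
  have hind : IndepFun (fun ω => ∑ b ∈ S, c * W b ω) (fun ω => ∑ b ∈ T, d * W b ω) P := by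
    have h := hi.indepFun_finset S T hST hm
    have h' := h.comp (φ := fun x : S → ℝ => ∑ b : S, c * x b)
      (ψ := fun x : T → ℝ => ∑ b : T, d * x b) (by fun_prop) (by fun_prop)
    convert h' using 1
    · ext ω; exact (Finset.sum_coe_sort S (fun b => c * W b ω)).symm
    · ext ω; exact (Finset.sum_coe_sort T (fun b => d * W b ω)).symm
  exact (measure_sq_add_sq_gt_of_indepFun (law S c hc) (law T d hd) hind hs).le

/-- A family of events indexed by a countable parameter and independent of a random choice of
that parameter keeps its probability bound when the parameter is chosen at random. -/
theorem measure_setOf_mem_le_of_indep {Ω κ : Type*} [Countable κ] {mΩ : MeasurableSpace Ω}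
    {P : Measure Ω} [IsProbabilityMeasure P] {m₁ m₂ : MeasurableSpace Ω} (h₁ : m₁ ≤ mΩ)
    (hind : Indep m₁ m₂ P) {T : Ω → κ} (hT : ∀ t, MeasurableSet[m₁] (T ⁻¹' {t}))
    {B : κ → Set Ω} (hB : ∀ t, MeasurableSet[m₂] (B t)) {ε : ℝ≥0∞}
    (hε : ∀ ω, P (B (T ω)) ≤ ε) : P {ω | ω ∈ B (T ω)} ≤ ε := by
  have hsub : {ω | ω ∈ B (T ω)} ⊆ ⋃ t, (T ⁻¹' {t} ∩ B t) := fun ω hω =>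
    Set.mem_iUnion.2 ⟨T ω, rfl, hω⟩
  calc P {ω | ω ∈ B (T ω)} ≤ ∑' t, P (T ⁻¹' {t} ∩ B t) :=
        (measure_mono hsub).trans (measure_iUnion_le _)
    _ ≤ ∑' t, P (T ⁻¹' {t}) * ε := by
        refine ENNReal.tsum_le_tsum fun t => ?_
        rw [(Indep_iff _ _ P).1 hind _ _ (hT t) (hB t)]
        rcases (T ⁻¹' {t}).eq_empty_or_nonempty with h | ⟨ω, hω⟩
        · simp [h]
        · have : T ω = t := hω
          exact mul_le_mul_right (this ▸ hε ω) _
    _ = P (⋃ t, T ⁻¹' {t}) * ε := by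
        rw [ENNReal.tsum_mul_right, measure_iUnion _ fun t => h₁ _ (hT t)]
        intro s t hst
        exact Set.disjoint_left.2 fun ω hs ht => hst (hs.symm.trans ht)
    _ ≤ ε := by
        calc _ ≤ 1 * ε := by gcongr; exact prob_le_one
          _ = ε := one_mul _

/-! ### Elementary properties of the algorithm -/

theorem uniformPulls_eq {n : ℕ} (hn : 1 ≤ n) (r : ℕ) : uniformPulls n r = 2 ^ r := by
  have hn' : (n : ℝ) ≠ 0 := by positivity
  have : (roundBudget n r : ℝ) / n = ((2 ^ r : ℕ) : ℝ) := by
    simp only [roundBudget]; push_cast; field_simp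
  rw [uniformPulls, this, Nat.ceil_natCast]

theorem cumUniformPulls_add_two {n : ℕ} (hn : 1 ≤ n) (r : ℕ) :
    cumUniformPulls n r + 2 = 2 * 2 ^ r := by
  induction r with
  | zero => simp [cumUniformPulls]
  | succ r ih =>
    have : cumUniformPulls n (r + 1) = cumUniformPulls n r + 2 ^ (r + 1) := by
      rw [cumUniformPulls, Finset.sum_Icc_succ_top (by omega), uniformPulls_eq hn]; rfl
    rw [this, pow_succ] ; omega

theorem cumUniformPulls_le {n : ℕ} (hn : 1 ≤ n) (r : ℕ) :
    (cumUniformPulls n r : ℝ) ≤ 2 * 2 ^ r := by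
  have := cumUniformPulls_add_two hn r
  have h : cumUniformPulls n r ≤ 2 * 2 ^ r := by omega
  exact_mod_cast h

theorem two_pow_le_cumUniformPulls {n : ℕ} (hn : 1 ≤ n) {r : ℕ} (hr : 1 ≤ r) :
    (2 : ℝ) ^ r ≤ cumUniformPulls n r := by
  have := cumUniformPulls_add_two hn r
  have h2 : 2 ^ 1 ≤ 2 ^ r := Nat.pow_le_pow_right two_pos hr
  have h : 2 ^ r ≤ cumUniformPulls n r := by omega
  exact_mod_cast h

theorem isCompact_box {n : ℕ} (x : EuclideanSpace ℝ (Fin n)) (c : ℝ) : IsCompact (box x c) := by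
  have h : IsCompact (Set.univ.pi fun i : Fin n => Set.Icc (x i - c) (x i + c)) :=
    isCompact_univ_pi fun i => isCompact_Icc
  have := h.image (PiLp.continuous_toLp 2 (fun _ : Fin n => ℝ))
  convert this using 1
  ext y
  constructor
  · intro hy
    refine ⟨y.ofLp, fun i _ => ?_, rfl⟩
    have := abs_le.1 (hy i)
    exact ⟨by linarith [this.1], by linarith [this.2]⟩
  · rintro ⟨z, hz, rfl⟩ i
    have := hz i trivial
    exact abs_le.2 ⟨by linarith [this.1], by linarith [this.2]⟩

theorem box_eq_image_add {n : ℕ} (x : EuclideanSpace ℝ (Fin n)) (c : ℝ) :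
    box x c = (fun z => x + z) '' box 0 c := by
  ext y
  constructor
  · intro hy
    exact ⟨y - x, fun i => by simpa using hy i, by simp⟩
  · rintro ⟨z, hz, rfl⟩ i
    simpa using hz i

theorem dist_le_of_mem_box {n : ℕ} {x y z : EuclideanSpace ℝ (Fin n)} {c : ℝ} (hc : 0 ≤ c)
    (hy : y ∈ box x c) (hz : z ∈ box x c) : dist y z ≤ √n * (2 * c) := by
  rw [EuclideanSpace.dist_eq, ← Real.sqrt_sq (by positivity : 0 ≤ 2 * c),
    ← Real.sqrt_mul (Nat.cast_nonneg n)]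
  refine Real.sqrt_le_sqrt ?_
  calc ∑ i, dist (y i) (z i) ^ 2 ≤ ∑ _i : Fin n, (2 * c) ^ 2 := by
        refine Finset.sum_le_sum fun i _ => pow_le_pow_left₀ dist_nonneg ?_ 2
        have := abs_sub_le (y i) (x i) (z i)
        rw [abs_sub_comm (x i)] at this
        rw [Real.dist_eq]
        linarith [hy i, hz i]
    _ = n * (2 * c) ^ 2 := by simp

/-- Translating the box to the origin turns this into a minimum over a fixed compact set. It serves
to make the sample sizes measurable functions of the uniform pulls. -/
theorem continuous_sInf_image_box {n : ℕ} {g : EuclideanSpace ℝ (Fin n) → ℝ} (hg : Continuous g)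
    (c : ℝ) : Continuous fun x => sInf (g '' box x c) := by
  have := (isCompact_box (0 : EuclideanSpace ℝ (Fin n)) c).continuous_sInf
    (f := fun x z => g (x + z)) (by fun_prop)
  refine this.congr fun x => ?_
  rw [box_eq_image_add x c, Set.image_image]

section
variable {n : ℕ} {f : EuclideanSpace ℝ (Fin n) → ℝ} {δ : ℝ} {X : Pull n → ℝ} {r : ℕ}

theorem gradLower_nonneg (i : Fin n) : 0 ≤ gradLower f δ X r i := by
  refine Real.sInf_nonneg ?_
  rintro _ ⟨y, _, rfl⟩
  exact abs_nonneg _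

theorem samplingFreq_nonneg (i : Fin n) : 0 ≤ samplingFreq f δ X r i := by
  unfold samplingFreq
  split_ifs
  · positivity
  · exact div_nonneg (gradLower_nonneg i) (Finset.sum_nonneg fun j _ => gradLower_nonneg j)

theorem sum_samplingFreq (hn : 1 ≤ n) : ∑ i, samplingFreq f δ X r i = 1 := by
  have hn' : (n : ℝ) ≠ 0 := by positivity
  unfold samplingFreq
  split_ifs with h
  · simp [hn']
  · rw [← Finset.sum_div, div_self h]

/-- Multiplied out, the proportionality also covers the uniform branch: a vanishing sum of
nonnegative terms has only zero terms. -/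
theorem samplingFreq_mul_sum (i : Fin n) :
    samplingFreq f δ X r i * ∑ j, gradLower f δ X r j = gradLower f δ X r i := by
  unfold samplingFreq
  split_ifs with h
  · rw [h, mul_zero]
    exact ((Finset.sum_eq_zero_iff_of_nonneg fun j _ => gradLower_nonneg j).1 h i
      (Finset.mem_univ i)).symm
  · rw [div_mul_cancel₀ _ h]

theorem samplingFreq_budget_le_weightedPulls (i : Fin n) :
    samplingFreq f δ X r i * (n * 2 ^ r) ≤ weightedPulls f δ X r i := by
  refine le_trans ?_ (Nat.le_ceil _)
  simp only [roundBudget, Nat.cast_mul, Nat.cast_pow, Nat.cast_ofNat]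
  gcongr
  simp

theorem two_pow_le_weightedPulls (i : Fin n) :
    (2 : ℝ) ^ r ≤ weightedPulls f δ X r i := by
  refine le_trans ?_ (Nat.le_ceil _)
  have hn : (0 : ℝ) < n := by exact_mod_cast i.pos
  have := samplingFreq_nonneg (f := f) (δ := δ) (X := X) (r := r) i
  simp only [roundBudget, Nat.cast_mul, Nat.cast_pow, Nat.cast_ofNat]
  calc (2 : ℝ) ^ r = (0 + 1 / n) * (n * 2 ^ r) := by field_simp; simp
    _ ≤ _ := by gcongr

theorem weightedPulls_le (i : Fin n) :
    (weightedPulls f δ X r i : ℝ) ≤ samplingFreq f δ X r i * (n * 2 ^ r) + 2 ^ r + 1 := by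
  have hn : (0 : ℝ) < n := by exact_mod_cast i.pos
  have h0 := samplingFreq_nonneg (f := f) (δ := δ) (X := X) (r := r) i
  refine (Nat.ceil_lt_add_one (by positivity)).le.trans (le_of_eq ?_)
  simp only [roundBudget, Nat.cast_mul, Nat.cast_pow, Nat.cast_ofNat]
  field_simp

/-- A single arm has no partner to be paired with, but it receives frequency `1` besides the
baseline `1 / n`, hence twice as many pulls, which recovers the same factor 2. -/
theorem cumUniformPulls_le_weightedPulls_of_subsingleton (i : Fin n) (hn : n = 1) :
    (cumUniformPulls n r : ℝ) ≤ weightedPulls f δ X r i := by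
  subst hn
  have h1 : samplingFreq f δ X r i = 1 := by
    have := sum_samplingFreq (f := f) (δ := δ) (X := X) (r := r) le_rfl
    rwa [Fintype.sum_subsingleton _ i] at this
  refine (cumUniformPulls_le le_rfl r).trans (le_trans (le_of_eq ?_) (Nat.le_ceil _))
  rw [h1, roundBudget]; push_cast; ring

/-- Round `l` costs `n 2^l` uniform and at most `2n 2^l + n` weighted pulls, the last `n` from
rounding up; the geometric sum doubles the final round. -/
theorem pullsThrough_le (hn : 1 ≤ n) : (pullsThrough f δ X r : ℝ) ≤ 8 * (n * 2 ^ r) := by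
  have hround : ∀ l, ((∑ i, (uniformPulls n l + weightedPulls f δ X l i) : ℕ) : ℝ) ≤
      4 * (n * 2 ^ l) := by
    intro l
    push_cast
    calc ∑ i, ((uniformPulls n l : ℝ) + weightedPulls f δ X l i)
        ≤ ∑ i, (2 ^ l + (samplingFreq f δ X l i * (n * 2 ^ l) + 2 ^ l + 1)) := by
          gcongr with i
          · rw [uniformPulls_eq hn]; simp
          · exact weightedPulls_le i
      _ = n * 2 ^ l + (n * 2 ^ l + n * 2 ^ l + n) := by
          simp [Finset.sum_add_distrib, ← Finset.sum_mul, sum_samplingFreq hn]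
      _ ≤ 4 * (n * 2 ^ l) := by
          have : (1 : ℝ) ≤ 2 ^ l := one_le_pow₀ one_le_two
          nlinarith [(Nat.cast_nonneg n : (0 : ℝ) ≤ n)]
  induction r with
  | zero => simp [pullsThrough]
  | succ r ih =>
    have : pullsThrough f δ X (r + 1) = pullsThrough f δ X r +
        ∑ i, (uniformPulls n (r + 1) + weightedPulls f δ X (r + 1) i) := by
      rw [pullsThrough, Finset.sum_Icc_succ_top (by omega)]; rfl
    rw [this, Nat.cast_add]
    have h2 := hround (r + 1)
    rw [pow_succ] at h2 ⊢
    linarith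

variable {L : ℝ≥0} (hL : LipschitzWith L (gradient f))
include hL

theorem continuous_abs_gradient_apply (i : Fin n) : Continuous fun y => |gradient f y i| := by
  have := hL.continuous
  fun_prop

theorem gradLower_le {y : EuclideanSpace ℝ (Fin n)}
    (hy : y ∈ box (muHat X r) (confWidth n δ r)) (i : Fin n) :
    gradLower f δ X r i ≤ |gradient f y i| :=
  csInf_le (((isCompact_box _ _).image (continuous_abs_gradient_apply hL i)).bddBelow)
    ⟨y, hy, rfl⟩

theorem le_gradUpper {y : EuclideanSpace ℝ (Fin n)}
    (hy : y ∈ box (muHat X r) (confWidth n δ r)) (i : Fin n) :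
    |gradient f y i| ≤ gradUpper f δ X r i :=
  le_csSup (((isCompact_box _ _).image (continuous_abs_gradient_apply hL i)).bddAbove)
    ⟨y, hy, rfl⟩

/-- Both extrema range over a box of Euclidean diameter at most `2c√n`. The point `y` only ensures
that the box is nonempty, so that `sSup` and `sInf` are not default values. -/
theorem gradUpper_le {y : EuclideanSpace ℝ (Fin n)}
    (hy : y ∈ box (muHat X r) (confWidth n δ r)) (i : Fin n) :
    gradUpper f δ X r i ≤ gradLower f δ X r i + L * (√n * (2 * confWidth n δ r)) := by
  have hne : (box (muHat X r) (confWidth n δ r)).Nonempty := ⟨y, hy⟩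
  refine csSup_le (hne.image _) ?_
  rintro _ ⟨z, hz, rfl⟩
  rw [← sub_le_iff_le_add]
  refine le_csInf (hne.image _) ?_
  rintro _ ⟨w, hw, rfl⟩
  have h1 : |gradient f z i - gradient f w i| ≤ dist (gradient f z) (gradient f w) := by
    rw [dist_eq_norm]
    exact PiLp.norm_apply_le (gradient f z - gradient f w) i
  have h2 := (hL.dist_le_mul z w).trans (mul_le_mul_of_nonneg_left
    (dist_le_of_mem_box (Real.sqrt_nonneg _) hz hw) L.2)
  have h3 := abs_sub_abs_le_abs_sub (gradient f z i) (gradient f w i)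
  have h4 : |gradient f z i| - |gradient f w i| ≤ L * (√n * (2 * confWidth n δ r)) :=
    h3.trans (h1.trans h2)
  dsimp only
  linarith

end

/-! ### The observations -/

/-- Makes `Pull n` countable, so that almost sure statements about single pulls hold for all pulls
at once. -/
instance : Finite Phase :=
  Finite.of_injective (fun p : Phase => match p with | .uniform => true | .weighted => false)
    (by rintro (_ | _) (_ | _) h <;> simp_all)

/-- The observations when the arms have means `μ` and the noise is `z`. -/
def observations {n : ℕ} (μ : EuclideanSpace ℝ (Fin n)) (z : Pull n → ℝ) : Pull n → ℝ :=
  fun a => μ a.1 + z a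

theorem muHat_observations_sub {n : ℕ} (hn : 1 ≤ n) (μ : EuclideanSpace ℝ (Fin n))
    (z : Pull n → ℝ) {r : ℕ} (hr : 1 ≤ r) (i : Fin n) :
    muHat (observations μ z) r i - μ i =
      ∑ b ∈ (Finset.Icc 1 r).sigma (fun l => Finset.range (uniformPulls n l)),
        (1 / (cumUniformPulls n r : ℝ)) * z (i, b.1, Phase.uniform, b.2) := by
  have hpos : (0 : ℝ) < cumUniformPulls n r :=
    lt_of_lt_of_le (by positivity) (two_pow_le_cumUniformPulls hn hr)
  rw [← Finset.mul_sum, Finset.sum_sigma]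
  simp only [muHat, observations, Finset.sum_add_distrib, Finset.sum_const, Finset.card_range]
  have h : (∑ l ∈ Finset.Icc 1 r, uniformPulls n l • μ i) = cumUniformPulls n r * μ i := by
    simp [cumUniformPulls, Finset.sum_mul]
  rw [h]
  field_simp
  ring

theorem muTilde_observations_sub {n : ℕ} (f : EuclideanSpace ℝ (Fin n) → ℝ) (δ : ℝ)
    (μ : EuclideanSpace ℝ (Fin n)) (z : Pull n → ℝ) (r : ℕ) (i : Fin n) :
    muTilde f δ (observations μ z) r i - μ i =
      ∑ k ∈ Finset.range (weightedPulls f δ (observations μ z) r i),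
        (1 / (weightedPulls f δ (observations μ z) r i : ℝ)) * z (i, r, Phase.weighted, k) := by
  have hpos : (0 : ℝ) < weightedPulls f δ (observations μ z) r i :=
    lt_of_lt_of_le (by positivity) (two_pow_le_weightedPulls i)
  rw [← Finset.mul_sum]
  simp only [muTilde]
  -- The count itself depends on the observations, so it is frozen before `observations` is
  -- unfolded.
  generalize weightedPulls f δ (observations μ z) r i = t at *
  simp only [observations, Finset.sum_add_distrib, Finset.sum_const, Finset.card_range,
    nsmul_eq_mul]
  field_simp
  ring

theorem measurable_weightedPulls {Ω : Type*} {m : MeasurableSpace Ω} {n : ℕ}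
    {f : EuclideanSpace ℝ (Fin n) → ℝ} (hf : Continuous (gradient f)) (δ : ℝ) (r : ℕ)
    {X : Ω → Pull n → ℝ}
    (hX : ∀ i l k, Measurable fun ω => X ω (i, l, Phase.uniform, k)) (i : Fin n) :
    Measurable fun ω => weightedPulls f δ (X ω) r i := by
  have h1 : Measurable fun ω => muHat (X ω) r := by
    refine (PiLp.continuous_toLp 2 (fun _ : Fin n => ℝ)).measurable.comp ?_
    refine measurable_pi_iff.2 fun i => Measurable.div_const ?_ _
    exact Finset.measurable_fun_sum _ fun l _ => Finset.measurable_fun_sum _ fun k _ => hX i l k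
  have h2 : ∀ j, Measurable fun ω => gradLower f δ (X ω) r j := fun j =>
    (continuous_sInf_image_box (g := fun y => |gradient f y j|) (by fun_prop)
      (confWidth n δ r)).measurable.comp h1
  have h3 : Measurable fun ω => ∑ j, gradLower f δ (X ω) r j :=
    Finset.measurable_fun_sum _ fun j _ => h2 j
  have h4 : Measurable fun ω => samplingFreq f δ (X ω) r i :=
    Measurable.ite (measurableSet_eq_fun h3 measurable_const) measurable_const ((h2 i).div h3)
  exact Nat.measurable_ceil.comp ((h4.add_const _).mul_const _)

/-! ### Tail bounds for the averages of one round -/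

section
variable {Ω : Type*} [MeasurableSpace Ω] {P : Measure Ω} [IsProbabilityMeasure P] {n : ℕ}
  {Z : Pull n → Ω → ℝ} (hm : ∀ a, Measurable (Z a))
  (hZ : ∀ a, HasLaw (Z a) (gaussianReal 0 1) P) (hi : iIndepFun Z P)
include hm hZ hi

theorem measure_confWidth_lt_abs_muHat_sub_le (hn : 1 ≤ n) (μ : EuclideanSpace ℝ (Fin n))
    {δ : ℝ} {r : ℕ} (hr : 1 ≤ r) (hlog : 0 ≤ Real.log (12 * n * (r : ℝ) ^ 2 / δ)) (i : Fin n) :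
    P {ω | confWidth n δ r < |muHat (observations μ fun a => Z a ω) r i - μ i|} ≤
      ENNReal.ofReal (2 * Real.exp (-Real.log (12 * n * (r : ℝ) ^ 2 / δ))) := by
  have hpos : (0 : ℝ) < cumUniformPulls n r :=
    lt_of_lt_of_le (by positivity) (two_pow_le_cumUniformPulls hn hr)
  have hinj : Function.Injective
      (fun b : (Σ _ : ℕ, ℕ) => ((i, b.1, Phase.uniform, b.2) : Pull n)) := by
    rintro ⟨a, b⟩ ⟨c, d⟩ h
    simp only [Prod.mk.injEq, true_and] at h
    rw [h.1, h.2]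
  have := measure_abs_sum_gt_le (fun b => hm _) (fun b => hZ _) (hi.precomp hinj)
    (fun _ => 1 / (cumUniformPulls n r : ℝ))
    ((Finset.Icc 1 r).sigma (fun l => Finset.range (uniformPulls n l))) hlog
  refine le_trans (measure_mono fun ω hω => ?_) this
  have hω' : confWidth n δ r < |muHat (observations μ fun a => Z a ω) r i - μ i| := hω
  rw [muHat_observations_sub hn μ _ hr] at hω'
  refine lt_of_le_of_lt (le_of_eq ?_) hω'
  rw [confWidth, Finset.sum_const, Finset.card_sigma]
  simp only [Finset.card_range]
  change √(2 * _ * (cumUniformPulls n r • _)) = _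
  congr 1
  rw [nsmul_eq_mul]
  field_simp

theorem measure_linear_term_gt_le (g : Fin n → ℝ) (r : ℕ) {t : Fin n → ℕ} (ht : ∀ i, 0 < t i)
    {l : ℝ} (hl : 0 ≤ l) :
    P {ω | √(2 * l * ∑ i, g i ^ 2 / (t i : ℝ)) <
        |∑ i, g i * ∑ k ∈ Finset.range (t i), (1 / (t i : ℝ)) * Z (i, r, Phase.weighted, k) ω|} ≤
      ENNReal.ofReal (2 * Real.exp (-l)) := by
  have hinj : Function.Injective
      (fun b : (Σ _ : Fin n, ℕ) => ((b.1, r, Phase.weighted, b.2) : Pull n)) := by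
    rintro ⟨a, b⟩ ⟨c, d⟩ h
    simp only [Prod.mk.injEq, true_and] at h
    rw [h.1, h.2]
  have := measure_abs_sum_gt_le (fun b => hm _) (fun b => hZ _) (hi.precomp hinj)
    (fun b => g b.1 * (1 / (t b.1 : ℝ)))
    (Finset.univ.sigma (fun i => Finset.range (t i))) hl
  simp only [Finset.sum_sigma, Finset.sum_const, Finset.card_range] at this
  have e1 : ∀ i, t i • (g i * (1 / (t i : ℝ))) ^ 2 = g i ^ 2 / (t i : ℝ) := fun i => by
    have : (t i : ℝ) ≠ 0 := by exact_mod_cast (ht i).ne'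
    rw [nsmul_eq_mul]; field_simp
  simpa only [e1, Finset.mul_sum, mul_assoc] using this

/-- For `n ≥ 2` each coordinate is paired with its cyclic successor, and a union bound is taken over
the `n` pairs. For `n = 1` the two-sided one-dimensional tail suffices, by `ht1`. -/
theorem measure_quadratic_term_gt_le (hn : 1 ≤ n) (r : ℕ) {t : Fin n → ℕ} {N T : ℝ}
    (hN : 0 < N) (hNT : N ≤ 2 * T) (hT : 0 < T) (ht : ∀ i, T ≤ t i)
    (ht1 : n = 1 → ∀ i, N ≤ t i) {s : ℝ} (hs : 0 ≤ s) :
    P {ω | 2 * n * s / N <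
        ∑ i, (∑ k ∈ Finset.range (t i), (1 / (t i : ℝ)) * Z (i, r, Phase.weighted, k) ω) ^ 2} ≤
      ENNReal.ofReal (2 * n * Real.exp (-s)) := by
  have ht0 : ∀ i, (0 : ℝ) < t i := fun i => hT.trans_le (ht i)
  have hinj : Function.Injective
      (fun b : (Σ _ : Fin n, ℕ) => ((b.1, r, Phase.weighted, b.2) : Pull n)) := by
    rintro ⟨a, b⟩ ⟨c, d⟩ h
    simp only [Prod.mk.injEq, true_and] at h
    rw [h.1, h.2]
  have hi' := hi.precomp hinj
  let S : Fin n → Finset (Σ _ : Fin n, ℕ) := fun i =>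
    ({i} : Finset (Fin n)).sigma fun j => Finset.range (t j)
  have hcard : ∀ i, (S i).card = t i := fun i => by simp [S]
  have hsum : ∀ i (c : ℝ) ω, ∑ b ∈ S i, c * Z (b.1, r, Phase.weighted, b.2) ω =
      c * ∑ k ∈ Finset.range (t i), Z (i, r, Phase.weighted, k) ω := fun i c ω => by
    simp [S, Finset.sum_sigma, Finset.mul_sum]
  simp only [← Finset.mul_sum, mul_pow]
  rcases eq_or_ne n 1 with hn1 | hn1
  · subst hn1
    have := measure_abs_sum_gt_le (fun b => hm _) (fun b => hZ _) hi' (fun _ => 1 / (t 0 : ℝ))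
      (S 0) hs
    refine (measure_mono fun ω hω => ?_).trans (this.trans (le_of_eq (by simp)))
    have hω' : 2 * ((1 : ℕ) : ℝ) * s / N <
      ∑ i, (1 / (t i : ℝ)) ^ 2 * (∑ k ∈ Finset.range (t i), Z (i, r, Phase.weighted, k) ω) ^ 2 := hω
    rw [Fin.sum_univ_one, ← mul_pow] at hω'
    change √(2 * s * ∑ b ∈ S 0, (1 / (t 0 : ℝ)) ^ 2) <
      |∑ b ∈ S 0, 1 / (t 0 : ℝ) * Z (b.1, r, Phase.weighted, b.2) ω|
    rw [hsum, Finset.sum_const, hcard, nsmul_eq_mul, ← Real.sqrt_sq_eq_abs]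
    refine Real.sqrt_lt_sqrt (by positivity) (lt_of_le_of_lt ?_ hω')
    have h0 := ht0 0
    have h1 := ht1 rfl 0
    calc 2 * s * (t 0 * (1 / (t 0 : ℝ)) ^ 2) = 2 * s / t 0 := by field_simp
      _ ≤ 2 * s / N := by gcongr
      _ = 2 * ((1 : ℕ) : ℝ) * s / N := by simp
  · have hn2 : 2 ≤ n := by omega
    -- The averages rescaled to unit variance.
    let Y : Fin n → Ω → ℝ := fun i ω => ∑ b ∈ S i, (1 / √(t i)) * Z (b.1, r, Phase.weighted, b.2) ω
    have hpair : ∀ i j, i ≠ j → P {ω | 2 * s < Y i ω ^ 2 + Y j ω ^ 2} ≤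
        ENNReal.ofReal (Real.exp (-s)) := by
      intro i j hij
      have hone : ∀ i, ((S i).card : ℝ) * (1 / √(t i)) ^ 2 = 1 := fun i => by
        have := ht0 i
        rw [hcard, div_pow, Real.sq_sqrt this.le]; field_simp
      refine measure_sum_sq_add_sum_sq_gt_le (fun b => hm _) (fun b => hZ _) hi' ?_
        (hone i) (hone j) hs
      refine Finset.disjoint_left.2 fun b hb hb' => hij ?_
      simp only [S, Finset.mem_sigma, Finset.mem_singleton] at hb hb'
      exact hb.1.symm.trans hb'.1
    have hrot : ∀ i : Fin n, i ≠ finRotate n i := by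
      obtain ⟨m, rfl⟩ : ∃ m, n = m + 2 := ⟨n - 2, by omega⟩
      intro i h
      rw [finRotate_apply] at h
      simp at h
    have hsub : {ω | 2 * n * s / N < ∑ i, (1 / (t i : ℝ)) ^ 2 *
        (∑ k ∈ Finset.range (t i), Z (i, r, Phase.weighted, k) ω) ^ 2} ⊆
        ⋃ i, {ω | 2 * s < Y i ω ^ 2 + Y (finRotate n i) ω ^ 2} := by
      intro ω hω
      by_contra hcon
      simp only [Set.mem_iUnion, Set.mem_ofPred_eq, not_exists, not_lt] at hcon hω
      have h1 : ∑ i, (Y i ω ^ 2 + Y (finRotate n i) ω ^ 2) ≤ ∑ _i : Fin n, 2 * s :=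
        Finset.sum_le_sum fun i _ => hcon i
      -- Every coordinate lies in two pairs, so `2 * ∑ Y² ≤ 2ns`: half of what coordinatewise bounds
      -- `Y² ≤ 2s` would give.
      rw [Finset.sum_add_distrib, Equiv.sum_comp (finRotate n) (fun i => Y i ω ^ 2)] at h1
      simp only [Finset.sum_const, Finset.card_univ, Fintype.card_fin, nsmul_eq_mul] at h1
      have h2 : ∑ i, Y i ω ^ 2 ≤ n * s := by linarith
      have h3 : ∀ i, (1 / (t i : ℝ)) ^ 2 *
          (∑ k ∈ Finset.range (t i), Z (i, r, Phase.weighted, k) ω) ^ 2 ≤ Y i ω ^ 2 / T := by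
        intro i
        have h0 := ht0 i
        have e : Y i ω ^ 2 / t i = (1 / (t i : ℝ)) ^ 2 *
            (∑ k ∈ Finset.range (t i), Z (i, r, Phase.weighted, k) ω) ^ 2 := by
          simp only [Y]
          rw [hsum, mul_pow, div_pow, Real.sq_sqrt h0.le]
          field_simp
        rw [← e]
        have := ht i
        gcongr
      have h4 : ∑ i, (1 / (t i : ℝ)) ^ 2 *
          (∑ k ∈ Finset.range (t i), Z (i, r, Phase.weighted, k) ω) ^ 2 ≤ n * s / T :=
        calc _ ≤ ∑ i, Y i ω ^ 2 / T := Finset.sum_le_sum fun i _ => h3 i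
          _ = (∑ i, Y i ω ^ 2) / T := (Finset.sum_div _ _ _).symm
          _ ≤ n * s / T := by gcongr
      have h5 : n * s / T ≤ 2 * n * s / N := by
        rw [div_le_div_iff₀ hT hN]
        nlinarith [mul_nonneg (Nat.cast_nonneg n : (0 : ℝ) ≤ n) hs]
      linarith
    calc _ ≤ ∑ i, P {ω | 2 * s < Y i ω ^ 2 + Y (finRotate n i) ω ^ 2} :=
          (measure_mono hsub).trans (measure_iUnion_fintype_le _ _)
      _ ≤ ∑ _i : Fin n, ENNReal.ofReal (Real.exp (-s)) :=
          Finset.sum_le_sum fun i _ => hpair i _ (hrot i)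
      _ = ENNReal.ofReal (n * Real.exp (-s)) := by
          rw [ENNReal.ofReal_mul (Nat.cast_nonneg n)]; simp
      _ ≤ ENNReal.ofReal (2 * n * Real.exp (-s)) := by
          refine ENNReal.ofReal_le_ofReal ?_
          gcongr
          linarith [(Nat.cast_nonneg n : (0 : ℝ) ≤ n)]

end

/-! ### The event that all confidence bounds hold -/

/-- All the confidence bounds used by the analysis of round `r` hold. -/
structure BoundsHold {n : ℕ} (f : EuclideanSpace ℝ (Fin n) → ℝ) (δ : ℝ)
    (μ : EuclideanSpace ℝ (Fin n)) (X : Pull n → ℝ) (r : ℕ) : Prop where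
  uniform : μ ∈ box (muHat X r) (confWidth n δ r)
  linear : |∑ i, gradient f μ i * (muTilde f δ X r i - μ i)| ≤
    √(2 * Real.log (24 * (r : ℝ) ^ 2 / δ) *
      ∑ i, gradient f μ i ^ 2 / (weightedPulls f δ X r i : ℝ))
  quadratic : ∑ i, (muTilde f δ X r i - μ i) ^ 2 ≤
    2 * n * Real.log (24 * n * (r : ℝ) ^ 2 / δ) / cumUniformPulls n r

section
variable {Ω : Type*} [MeasurableSpace Ω] {P : Measure Ω} [IsProbabilityMeasure P] {n : ℕ}
  {Z : Pull n → Ω → ℝ} (hm : ∀ a, Measurable (Z a))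
  (hZ : ∀ a, HasLaw (Z a) (gaussianReal 0 1) P) (hi : iIndepFun Z P)
include hm hZ hi

omit hZ in
/-- Bounds on the weighted averages that hold for fixed sample sizes persist when the sample
sizes are the random ones chosen by the algorithm, since these depend on uniform pulls only. -/
theorem measure_weightedPulls_mem_le {f : EuclideanSpace ℝ (Fin n) → ℝ}
    (hf : Continuous (gradient f)) (δ : ℝ) (μ : EuclideanSpace ℝ (Fin n)) (r : ℕ)
    (B : (Fin n → ℕ) → Set (Fin n → ℝ)) (hB : ∀ t, MeasurableSet (B t)) {ε : ℝ≥0∞}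
    (hε : ∀ X : Pull n → ℝ, P {ω | (fun i =>
      ∑ k ∈ Finset.range (weightedPulls f δ X r i), (1 / (weightedPulls f δ X r i : ℝ)) *
        Z (i, r, Phase.weighted, k) ω) ∈ B (weightedPulls f δ X r)} ≤ ε) :
    P {ω | (fun i => muTilde f δ (observations μ fun a => Z a ω) r i - μ i) ∈
      B (weightedPulls f δ (observations μ fun a => Z a ω) r)} ≤ ε := by
  -- The σ-algebra generated by all noise of one phase, over all rounds; the two phases are
  -- independent.
  let m : Phase → MeasurableSpace Ω := fun p =>
    ⨆ a ∈ {a : Pull n | a.2.2.1 = p}, MeasurableSpace.comap (Z a) inferInstance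
  have hle : ∀ a : Pull n, MeasurableSpace.comap (Z a) inferInstance ≤ ‹MeasurableSpace Ω› :=
    fun a => (hm a).comap_le
  have hind : Indep (m Phase.uniform) (m Phase.weighted) P := by
    refine indep_iSup_of_disjoint hle hi (Set.disjoint_left.2 fun a ha ha' => ?_)
    have h1 : a.2.2.1 = Phase.uniform := ha
    have h2 : a.2.2.1 = Phase.weighted := ha'
    rw [h1] at h2
    cases h2
  have hmeas : ∀ a : Pull n, Measurable[m a.2.2.1] (Z a) := fun a =>
    measurable_iff_comap_le.2 (le_iSup₂_of_le (f := fun (b : Pull n)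
      (_ : b ∈ {b : Pull n | b.2.2.1 = a.2.2.1}) => MeasurableSpace.comap (Z b) inferInstance)
      a rfl le_rfl)
  have hT : Measurable[m Phase.uniform] fun ω =>
      weightedPulls f δ (observations μ fun a => Z a ω) r := by
    refine @measurable_pi_lambda _ _ _ (m Phase.uniform) _ _ fun i => ?_
    refine @measurable_weightedPulls _ (m Phase.uniform) _ _ hf _ _ _ (fun i l k => ?_) _
    exact (hmeas (i, l, Phase.uniform, k)).const_add (μ i)
  have hA : ∀ t : Fin n → ℕ, Measurable[m Phase.weighted] fun ω => fun i =>
      ∑ k ∈ Finset.range (t i), (1 / (t i : ℝ)) * Z (i, r, Phase.weighted, k) ω := by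
    intro t
    refine @measurable_pi_lambda _ _ _ (m Phase.weighted) _ _ fun i => ?_
    refine @Finset.measurable_fun_sum _ _ _ _ _ _ (m Phase.weighted) _ _ fun k _ => ?_
    exact (hmeas (i, r, Phase.weighted, k)).const_mul _
  have := measure_setOf_mem_le_of_indep (iSup₂_le fun a _ => hle a) hind
    (fun t => hT (MeasurableSet.singleton t)) (fun t => hA t (hB t))
    (ε := ε) fun ω => hε _
  refine le_trans (measure_mono fun ω hω => ?_) this
  have hω' : (fun i => muTilde f δ (observations μ fun a => Z a ω) r i - μ i) ∈
      B (weightedPulls f δ (observations μ fun a => Z a ω) r) := hω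
  simp only [muTilde_observations_sub] at hω'
  exact hω'

theorem measure_not_boundsHold_le (hn : 1 ≤ n) {f : EuclideanSpace ℝ (Fin n) → ℝ}
    (hf : Continuous (gradient f)) (μ : EuclideanSpace ℝ (Fin n)) {δ : ℝ} (hδ : 0 < δ)
    (hδ1 : δ < 1) {r : ℕ} (hr : 1 ≤ r) :
    P {ω | ¬ BoundsHold f δ μ (observations μ fun a => Z a ω) r} ≤
      ENNReal.ofReal (δ / (3 * (r : ℝ) ^ 2)) := by
  have hn1 : (1 : ℝ) ≤ n := by exact_mod_cast hn
  have hr1 : (1 : ℝ) ≤ r := by exact_mod_cast hr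
  have hr2 : (1 : ℝ) ≤ (r : ℝ) ^ 2 := one_le_pow₀ hr1
  have hnr : (1 : ℝ) ≤ n * (r : ℝ) ^ 2 := one_le_mul_of_one_le_of_one_le hn1 hr2
  have hl1 : 0 ≤ Real.log (12 * n * (r : ℝ) ^ 2 / δ) :=
    Real.log_nonneg ((one_le_div hδ).2 (by nlinarith))
  have hl2 : 0 ≤ Real.log (24 * (r : ℝ) ^ 2 / δ) :=
    Real.log_nonneg ((one_le_div hδ).2 (by nlinarith))
  have hl3 : 0 ≤ Real.log (24 * n * (r : ℝ) ^ 2 / δ) :=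
    Real.log_nonneg ((one_le_div hδ).2 (by nlinarith))
  have hexp : ∀ x : ℝ, 0 < x → Real.exp (-Real.log (x / δ)) = δ / x := fun x hx => by
    rw [Real.exp_neg, Real.exp_log (by positivity), inv_div]
  have hpos : (0 : ℝ) < cumUniformPulls n r :=
    lt_of_lt_of_le (by positivity) (two_pow_le_cumUniformPulls hn hr)
  have hpow : (0 : ℝ) < 2 ^ r := by positivity
  have h1 : P (⋃ i, {ω | confWidth n δ r <
      |muHat (observations μ fun a => Z a ω) r i - μ i|}) ≤
      ENNReal.ofReal (δ / (6 * (r : ℝ) ^ 2)) := by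
    calc _ ≤ ∑ _i : Fin n, ENNReal.ofReal (2 * Real.exp (-Real.log (12 * n * (r : ℝ) ^ 2 / δ))) :=
          (measure_iUnion_fintype_le _ _).trans (Finset.sum_le_sum fun i _ =>
            measure_confWidth_lt_abs_muHat_sub_le hm hZ hi hn μ hr hl1 i)
      _ = ENNReal.ofReal (n * (2 * Real.exp (-Real.log (12 * n * (r : ℝ) ^ 2 / δ)))) := by
          rw [ENNReal.ofReal_mul (Nat.cast_nonneg n)]; simp
      _ = _ := by
          rw [hexp _ (by positivity)]; congr 1; field_simp; norm_num
  have h2 : P {ω | √(2 * Real.log (24 * (r : ℝ) ^ 2 / δ) * ∑ i, gradient f μ i ^ 2 /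
        (weightedPulls f δ (observations μ fun a => Z a ω) r i : ℝ)) <
      |∑ i, gradient f μ i * (muTilde f δ (observations μ fun a => Z a ω) r i - μ i)|} ≤
      ENNReal.ofReal (δ / (12 * (r : ℝ) ^ 2)) := by
    refine measure_weightedPulls_mem_le hm hi hf δ μ r
      (fun t => {x | √(2 * Real.log (24 * (r : ℝ) ^ 2 / δ) * ∑ i, gradient f μ i ^ 2 /
        (t i : ℝ)) < |∑ i, gradient f μ i * x i|})
      (fun t => measurableSet_lt (by fun_prop) (by fun_prop)) fun X => ?_
    refine (measure_linear_term_gt_le hm hZ hi (fun i => gradient f μ i) r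
      (t := weightedPulls f δ X r) (fun i => ?_) hl2).trans (le_of_eq ?_)
    · exact_mod_cast hpow.trans_le (two_pow_le_weightedPulls (f := f) (δ := δ) (X := X) i)
    · rw [hexp _ (by positivity)]; congr 1; field_simp; norm_num
  have h3 : P {ω | 2 * n * Real.log (24 * n * (r : ℝ) ^ 2 / δ) / cumUniformPulls n r <
      ∑ i, (muTilde f δ (observations μ fun a => Z a ω) r i - μ i) ^ 2} ≤
      ENNReal.ofReal (δ / (12 * (r : ℝ) ^ 2)) := by
    refine measure_weightedPulls_mem_le hm hi hf δ μ r
      (fun _ => {x | 2 * n * Real.log (24 * n * (r : ℝ) ^ 2 / δ) / cumUniformPulls n r <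
        ∑ i, x i ^ 2})
      (fun t => measurableSet_lt (by fun_prop) (by fun_prop)) fun X => ?_
    refine (measure_quadratic_term_gt_le hm hZ hi hn r (t := weightedPulls f δ X r) hpos
      (cumUniformPulls_le hn r) hpow (fun i => two_pow_le_weightedPulls i)
      (fun h i => cumUniformPulls_le_weightedPulls_of_subsingleton i h) hl3).trans (le_of_eq ?_)
    rw [hexp _ (by positivity)]; congr 1; field_simp; norm_num
  have hsub : {ω | ¬ BoundsHold f δ μ (observations μ fun a => Z a ω) r} ⊆
      (⋃ i, {ω | confWidth n δ r < |muHat (observations μ fun a => Z a ω) r i - μ i|}) ∪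
      ({ω | √(2 * Real.log (24 * (r : ℝ) ^ 2 / δ) * ∑ i, gradient f μ i ^ 2 /
        (weightedPulls f δ (observations μ fun a => Z a ω) r i : ℝ)) <
      |∑ i, gradient f μ i * (muTilde f δ (observations μ fun a => Z a ω) r i - μ i)|} ∪
      {ω | 2 * n * Real.log (24 * n * (r : ℝ) ^ 2 / δ) / cumUniformPulls n r <
      ∑ i, (muTilde f δ (observations μ fun a => Z a ω) r i - μ i) ^ 2}) := by
    intro ω hω
    by_contra hcon
    simp only [Set.mem_union, Set.mem_iUnion, Set.mem_ofPred_eq, not_or, not_exists,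
      not_lt] at hcon
    refine hω ⟨fun i => ?_, hcon.2.1, hcon.2.2⟩
    rw [abs_sub_comm]
    exact hcon.1 i
  calc _ ≤ _ := measure_mono hsub
    _ ≤ _ := (measure_union_le _ _).trans (add_le_add h1 ((measure_union_le _ _).trans
        (add_le_add h2 h3)))
    _ = _ := by
        rw [← ENNReal.ofReal_add (by positivity) (by positivity),
          ← ENNReal.ofReal_add (by positivity) (by positivity)]
        congr 1
        field_simp
        norm_num

theorem ofReal_one_sub_le_measure_boundsHold_of_measurable (hn : 1 ≤ n)
    {f : EuclideanSpace ℝ (Fin n) → ℝ}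
    (hf : Continuous (gradient f)) (μ : EuclideanSpace ℝ (Fin n)) {δ : ℝ} (hδ : 0 < δ)
    (hδ1 : δ < 1) :
    ENNReal.ofReal (1 - δ) ≤
      P {ω | ∀ r, 1 ≤ r → BoundsHold f δ μ (observations μ fun a => Z a ω) r} := by
  set G := {ω | ∀ r, 1 ≤ r → BoundsHold f δ μ (observations μ fun a => Z a ω) r} with hG
  have hbad : P Gᶜ ≤ ENNReal.ofReal δ := by
    have hsub : Gᶜ ⊆ ⋃ r : ℕ,
        {ω | ¬ BoundsHold f δ μ (observations μ fun a => Z a ω) (r + 1)} := by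
      intro ω hω
      simp only [hG, Set.mem_compl_iff, Set.mem_ofPred_eq, not_forall] at hω
      obtain ⟨r, hr, h⟩ := hω
      refine Set.mem_iUnion.2 ⟨r - 1, ?_⟩
      rwa [Set.mem_ofPred_eq, Nat.sub_add_cancel hr]
    have hs : HasSum (fun r : ℕ => δ / (3 * ((r + 1 : ℕ) : ℝ) ^ 2))
        (δ / 3 * (Real.pi ^ 2 / 6)) := by
      have h := (hasSum_nat_add_iff' 1).2 hasSum_zeta_two
      simp only [Finset.range_one, Finset.sum_singleton, Nat.cast_zero, ne_eq, OfNat.ofNat_ne_zero,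
        not_false_eq_true, zero_pow, div_zero, sub_zero] at h
      have e : (fun r : ℕ => δ / (3 * ((r + 1 : ℕ) : ℝ) ^ 2)) =
          fun r : ℕ => δ / 3 * (1 / ((r + 1 : ℕ) : ℝ) ^ 2) := by
        ext r; field_simp
      rw [e]
      exact h.mul_left (δ / 3)
    calc P Gᶜ ≤ ∑' r : ℕ, ENNReal.ofReal (δ / (3 * ((r + 1 : ℕ) : ℝ) ^ 2)) :=
          (measure_mono hsub).trans ((measure_iUnion_le _).trans (ENNReal.tsum_le_tsum fun r =>
            measure_not_boundsHold_le hm hZ hi hn hf μ hδ hδ1 (Nat.le_add_left 1 r)))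
      _ = ENNReal.ofReal (δ / 3 * (Real.pi ^ 2 / 6)) := by
          rw [← hs.tsum_eq, ENNReal.ofReal_tsum_of_nonneg (fun r => by positivity) hs.summable]
      _ ≤ ENNReal.ofReal δ := by
          -- The total is `δπ²/18`, and the crude bound `π < 4` already brings it below `δ`.
          refine ENNReal.ofReal_le_ofReal ?_
          have : Real.pi ^ 2 ≤ 4 ^ 2 := pow_le_pow_left₀ Real.pi_pos.le Real.pi_lt_four.le 2
          nlinarith
  rw [ENNReal.ofReal_sub _ hδ.le, ENNReal.ofReal_one, tsub_le_iff_right]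
  calc (1 : ℝ≥0∞) = P Set.univ := measure_univ.symm
    _ ≤ P G + P Gᶜ := by rw [← Set.union_compl_self G]; exact measure_union_le _ _
    _ ≤ _ := by gcongr

end

/-- `HasLaw` provides only almost everywhere measurability; passing to measurable versions of the
countably many `Z a` alters the event by a null set. -/
theorem ofReal_one_sub_le_measure_boundsHold {Ω : Type*} [MeasurableSpace Ω] {P : Measure Ω}
    [IsProbabilityMeasure P] {n : ℕ} {Z : Pull n → Ω → ℝ}
    (hZ : ∀ a, HasLaw (Z a) (gaussianReal 0 1) P) (hi : iIndepFun Z P) (hn : 1 ≤ n)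
    {f : EuclideanSpace ℝ (Fin n) → ℝ}
    (hf : Continuous (gradient f)) (μ : EuclideanSpace ℝ (Fin n)) {δ : ℝ} (hδ : 0 < δ)
    (hδ1 : δ < 1) :
    ENNReal.ofReal (1 - δ) ≤
      P {ω | ∀ r, 1 ≤ r → BoundsHold f δ μ (observations μ fun a => Z a ω) r} := by
  have hae : ∀ a, Z a =ᵐ[P] (hZ a).aemeasurable.mk (Z a) := fun a => (hZ a).aemeasurable.ae_eq_mk
  refine (ofReal_one_sub_le_measure_boundsHold_of_measurable
    (Z := fun a => (hZ a).aemeasurable.mk (Z a)) (fun a => (hZ a).aemeasurable.measurable_mk)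
    (fun a => (hZ a).congr (hae a).symm) (hi.congr hae) hn hf μ hδ hδ1).trans (le_of_eq ?_)
  refine measure_congr ?_
  filter_upwards [ae_all_iff.2 hae] with ω hω
  have : (fun a => (hZ a).aemeasurable.mk (Z a) ω) = fun a => Z a ω := funext fun a => (hω a).symm
  exact congrArg (fun z => ∀ r, 1 ≤ r → BoundsHold f δ μ (observations μ z) r) this

/-! ### Deterministic analysis -/

/-- Along the segment from `x` to `y` the remainder has derivative at most `L‖v‖²t` in absolute
value, so it is dominated by `L/2 * ‖v‖² * t²`. -/
theorem abs_sub_sub_inner_gradient_le {E : Type*} [NormedAddCommGroup E] [InnerProductSpace ℝ E]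
    [CompleteSpace E] {f : E → ℝ} {L : ℝ≥0} (hf : Differentiable ℝ f)
    (hL : LipschitzWith L (gradient f)) (x y : E) :
    |f y - f x - inner ℝ (gradient f x) (y - x)| ≤ L / 2 * ‖y - x‖ ^ 2 := by
  set v := y - x with hv
  have hd : ∀ t : ℝ, HasDerivAt (fun t : ℝ => f (x + t • v) - f x - t * inner ℝ (gradient f x) v)
      (inner ℝ (gradient f (x + t • v)) v - inner ℝ (gradient f x) v) t := by
    intro t
    have h1 : HasDerivAt (fun t : ℝ => x + t • v) v t := by
      simpa using ((hasDerivAt_id t).smul_const v).const_add x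
    have h2 := (hf (x + t • v)).hasFDerivAt.comp_hasDerivAt t h1
    rw [← inner_gradient_left] at h2
    have h3 := (h2.sub_const (f x)).sub ((hasDerivAt_id t).mul_const (inner ℝ (gradient f x) v))
    exact h3.congr_deriv (by simp)
  have hB : ∀ t : ℝ, HasDerivAt (fun t : ℝ => L / 2 * ‖v‖ ^ 2 * t ^ 2) (L * ‖v‖ ^ 2 * t) t := by
    intro t
    refine ((hasDerivAt_pow 2 t).const_mul (L / 2 * ‖v‖ ^ 2)).congr_deriv ?_
    push_cast; ring
  have := image_norm_le_of_norm_deriv_right_le_deriv_boundary (a := (0 : ℝ)) (b := 1)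
    (f := fun t : ℝ => f (x + t • v) - f x - t * inner ℝ (gradient f x) v)
    (fun t _ => (hd t).continuousAt.continuousWithinAt) (fun t _ => (hd t).hasDerivWithinAt)
    (B := fun t : ℝ => L / 2 * ‖v‖ ^ 2 * t ^ 2) (by simp) hB
    (fun t ht => by
      rw [← inner_sub_left]
      have h1 := hL.dist_le_mul (x + t • v) x
      rw [dist_eq_norm, dist_eq_norm, add_sub_cancel_left, norm_smul, Real.norm_eq_abs,
        abs_of_nonneg ht.1] at h1
      calc _ ≤ ‖gradient f (x + t • v) - gradient f x‖ * ‖v‖ := norm_inner_le_norm _ _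
        _ ≤ (L * (t * ‖v‖)) * ‖v‖ := by gcongr
        _ = L * ‖v‖ ^ 2 * t := by ring)
    (Set.right_mem_Icc.2 zero_le_one)
  simpa [hv] using this

section
variable {n : ℕ} {f : EuclideanSpace ℝ (Fin n) → ℝ} {δ : ℝ} {μ : EuclideanSpace ℝ (Fin n)}
  {X : Pull n → ℝ} {r : ℕ} {L : ℝ≥0}

theorem log_round_nonneg {n : ℕ} (hn : 1 ≤ n) {δ : ℝ} (hδ : 0 < δ) (hδ1 : δ < 1) {r : ℕ}
    (hr : 1 ≤ r) {a : ℝ} (ha : 1 ≤ a) : 0 ≤ Real.log (a * n * (r : ℝ) ^ 2 / δ) := by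
  have hn1 : (1 : ℝ) ≤ n := by exact_mod_cast hn
  have hr2 : (1 : ℝ) ≤ (r : ℝ) ^ 2 := one_le_pow₀ (by exact_mod_cast hr)
  have : 1 ≤ a * n * (r : ℝ) ^ 2 :=
    one_le_mul_of_one_le_of_one_le (one_le_mul_of_one_le_of_one_le ha hn1) hr2
  exact Real.log_nonneg ((one_le_div hδ).2 (by linarith))

theorem BoundsHold.abs_sub_le_funConfWidth (h : BoundsHold f δ μ X r) (hf : Differentiable ℝ f)
    (hL : LipschitzWith L (gradient f)) (hδ : 0 < δ) (hδ1 : δ < 1) (hr : 1 ≤ r) :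
    |f (muTilde f δ X r) - f μ| ≤ funConfWidth f L δ X r := by
  have hl : 0 ≤ Real.log (24 * (r : ℝ) ^ 2 / δ) := by
    simpa using log_round_nonneg le_rfl hδ hδ1 hr (a := 24) (by norm_num)
  have h1 := abs_sub_sub_inner_gradient_le hf hL μ (muTilde f δ X r)
  have h2 : inner ℝ (gradient f μ) (muTilde f δ X r - μ) =
      ∑ i, gradient f μ i * (muTilde f δ X r i - μ i) := by
    rw [PiLp.inner_apply]
    exact Finset.sum_congr rfl fun i _ => by simp [mul_comm]
  have h3 : ‖muTilde f δ X r - μ‖ ^ 2 = ∑ i, (muTilde f δ X r i - μ i) ^ 2 := by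
    rw [EuclideanSpace.norm_sq_eq]; simp
  rw [h2, h3] at h1
  have h4 : √(2 * Real.log (24 * (r : ℝ) ^ 2 / δ) *
      ∑ i, gradient f μ i ^ 2 / (weightedPulls f δ X r i : ℝ)) ≤
      √(2 * Real.log (24 * (r : ℝ) ^ 2 / δ) *
      ∑ i, gradUpper f δ X r i ^ 2 / (weightedPulls f δ X r i : ℝ)) := by
    refine Real.sqrt_le_sqrt (mul_le_mul_of_nonneg_left
      (Finset.sum_le_sum fun i _ => ?_) (by positivity))
    rw [← sq_abs (gradient f μ i)]
    have := le_gradUpper hL h.uniform i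
    gcongr
  have h5 : (L : ℝ) / 2 * ∑ i, (muTilde f δ X r i - μ i) ^ 2 ≤
      L * n * Real.log (24 * n * (r : ℝ) ^ 2 / δ) / cumUniformPulls n r := by
    calc _ ≤ (L : ℝ) / 2 *
          (2 * n * Real.log (24 * n * (r : ℝ) ^ 2 / δ) / cumUniformPulls n r) := by
          gcongr; exact h.quadratic
      _ = _ := by ring
  have h6 := h.linear
  rw [funConfWidth]
  rw [abs_le] at h1 h6 ⊢
  constructor <;> linarith [h1.1, h1.2, h6.1, h6.2]

/-- Write the upper bound as at most the lower bound `g i` plus an oscillation `D`. Since `α i * S =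
g i` for `S = ∑ g`, the pulls `α i * n * 2^r` turn `g i ^ 2 / T` into at most `g i * S / (n 2^r)`,
which sums to `S² / (n 2^r)` with `S ≤ ‖∇f(μ)‖₁`. The `D` part needs only the baseline of `2^r`
pulls per arm. -/
theorem BoundsHold.sum_gradUpper_sq_div_le (h : BoundsHold f δ μ X r)
    (hL : LipschitzWith L (gradient f)) (hn : 1 ≤ n) (hδ : 0 < δ) (hδ1 : δ < 1) (hr : 1 ≤ r) :
    ∑ i, gradUpper f δ X r i ^ 2 / (weightedPulls f δ X r i : ℝ) ≤
      2 * gradL1 f μ ^ 2 / (n * 2 ^ r) +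
        16 * (n * L / 2 ^ r) ^ 2 * Real.log (24 * n * (r : ℝ) ^ 2 / δ) := by
  have hn1 : (1 : ℝ) ≤ n := by exact_mod_cast hn
  have hpow : (0 : ℝ) < 2 ^ r := by positivity
  have hr1 : (0 : ℝ) < r := by exact_mod_cast hr
  set s := Real.log (24 * n * (r : ℝ) ^ 2 / δ)
  have hs : 0 ≤ s := log_round_nonneg hn hδ hδ1 hr (by norm_num)
  have hs' : 0 ≤ Real.log (12 * n * (r : ℝ) ^ 2 / δ) :=
    log_round_nonneg hn hδ hδ1 hr (by norm_num)
  have hss : Real.log (12 * n * (r : ℝ) ^ 2 / δ) ≤ s := by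
    refine Real.log_le_log (by positivity) ?_
    gcongr
    norm_num
  set D := (L : ℝ) * (√n * (2 * confWidth n δ r)) with hD
  have hcum := two_pow_le_cumUniformPulls hn hr
  have hc : confWidth n δ r ^ 2 ≤ 2 * s / 2 ^ r := by
    rw [confWidth, Real.sq_sqrt (by positivity)]
    gcongr
  have hD2 : D ^ 2 ≤ 8 * (n * L ^ 2) * s / 2 ^ r := by
    calc D ^ 2 = 4 * (n * L ^ 2) * confWidth n δ r ^ 2 := by
          rw [hD, mul_pow, mul_pow, Real.sq_sqrt (by positivity)]; ring
      _ ≤ 4 * (n * L ^ 2) * (2 * s / 2 ^ r) := by gcongr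
      _ = _ := by ring
  set S := ∑ j, gradLower f δ X r j
  have hS0 : 0 ≤ S := Finset.sum_nonneg fun j _ => gradLower_nonneg j
  have hSG : S ≤ gradL1 f μ := Finset.sum_le_sum fun j _ => gradLower_le hL h.uniform j
  have hterm : ∀ i, gradUpper f δ X r i ^ 2 / (weightedPulls f δ X r i : ℝ) ≤
      2 * (gradLower f δ X r i * S / (n * 2 ^ r)) + 2 * (D ^ 2 / 2 ^ r) := by
    intro i
    have hT := two_pow_le_weightedPulls (f := f) (δ := δ) (X := X) (r := r) i
    have hT' := samplingFreq_budget_le_weightedPulls (f := f) (δ := δ) (X := X) (r := r) i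
    have hα := samplingFreq_mul_sum (f := f) (δ := δ) (X := X) (r := r) i
    have hα0 := samplingFreq_nonneg (f := f) (δ := δ) (X := X) (r := r) i
    have hg0 := gradLower_nonneg (f := f) (δ := δ) (X := X) (r := r) i
    have hU := gradUpper_le hL h.uniform i
    have hU0 : 0 ≤ gradUpper f δ X r i := (abs_nonneg _).trans (le_gradUpper hL h.uniform i)
    set T : ℝ := ((weightedPulls f δ X r i : ℕ) : ℝ)
    have hT0 : 0 < T := hpow.trans_le hT
    have h1 : gradUpper f δ X r i ^ 2 ≤ 2 * gradLower f δ X r i ^ 2 + 2 * D ^ 2 := by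
      calc _ ≤ (gradLower f δ X r i + D) ^ 2 := by gcongr
        _ ≤ _ := by nlinarith [sq_nonneg (gradLower f δ X r i - D)]
    have h2 : gradLower f δ X r i ^ 2 / T ≤ gradLower f δ X r i * S / (n * 2 ^ r) := by
      rw [div_le_div_iff₀ hT0 (by positivity)]
      calc gradLower f δ X r i ^ 2 * (n * 2 ^ r)
          = (gradLower f δ X r i * S) * (samplingFreq f δ X r i * (n * 2 ^ r)) := by
            linear_combination (-(gradLower f δ X r i * (n * 2 ^ r))) * hα
        _ ≤ _ := by gcongr
    have h3 : D ^ 2 / T ≤ D ^ 2 / 2 ^ r := by gcongr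
    calc _ ≤ (2 * gradLower f δ X r i ^ 2 + 2 * D ^ 2) / T := by gcongr
      _ = 2 * (gradLower f δ X r i ^ 2 / T) + 2 * (D ^ 2 / T) := by ring
      _ ≤ _ := by gcongr
  calc _ ≤ ∑ i, (2 * (gradLower f δ X r i * S / (n * 2 ^ r)) + 2 * (D ^ 2 / 2 ^ r)) :=
        Finset.sum_le_sum fun i _ => hterm i
    _ = 2 * S ^ 2 / (n * 2 ^ r) + n * (2 * (D ^ 2 / 2 ^ r)) := by
        rw [Finset.sum_add_distrib, ← Finset.mul_sum, ← Finset.sum_div, ← Finset.sum_mul]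
        simp only [Finset.sum_const, Finset.card_univ, Fintype.card_fin, nsmul_eq_mul]
        ring
    _ ≤ 2 * gradL1 f μ ^ 2 / (n * 2 ^ r) + n * (2 * (8 * (n * L ^ 2) * s / 2 ^ r / 2 ^ r)) := by
        gcongr
    _ = _ := by ring

theorem BoundsHold.funConfWidth_le (h : BoundsHold f δ μ X r)
    (hL : LipschitzWith L (gradient f)) (hn : 1 ≤ n) (hδ : 0 < δ) (hδ1 : δ < 1) (hr : 1 ≤ r)
    {Δ : ℝ} (hΔ : 0 < Δ)
    (h1 : 64 * gradL1 f μ ^ 2 * Real.log (24 * (r : ℝ) ^ 2 / δ) ≤ Δ ^ 2 * (n * 2 ^ r))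
    (h2 : 28 * (n * L * Real.log (24 * n * (r : ℝ) ^ 2 / δ)) ≤ Δ * 2 ^ r) :
    funConfWidth f L δ X r ≤ Δ / 2 := by
  have hn1 : (1 : ℝ) ≤ n := by exact_mod_cast hn
  have hpow : (0 : ℝ) < 2 ^ r := by positivity
  have hr1 : (0 : ℝ) < r := by exact_mod_cast hr
  have hsum := h.sum_gradUpper_sq_div_le hL hn hδ hδ1 hr
  have hl : 0 ≤ Real.log (24 * (r : ℝ) ^ 2 / δ) := by
    simpa using log_round_nonneg le_rfl hδ hδ1 hr (a := 24) (by norm_num)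
  have hs : 0 ≤ Real.log (24 * n * (r : ℝ) ^ 2 / δ) :=
    log_round_nonneg hn hδ hδ1 hr (by norm_num)
  have hls : Real.log (24 * (r : ℝ) ^ 2 / δ) ≤ Real.log (24 * n * (r : ℝ) ^ 2 / δ) := by
    refine Real.log_le_log (by positivity) ?_
    gcongr
    nlinarith
  rw [funConfWidth]
  set l := Real.log (24 * (r : ℝ) ^ 2 / δ)
  set s := Real.log (24 * n * (r : ℝ) ^ 2 / δ)
  set q := n * L * s / 2 ^ r with hq
  have hq0 : 0 ≤ q := by positivity
  have hqΔ : 28 * q ≤ Δ := by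
    rw [hq, ← mul_div_assoc, div_le_iff₀ hpow]; exact h2
  have ha : 64 * (gradL1 f μ ^ 2 * l / (n * 2 ^ r)) ≤ Δ ^ 2 := by
    rw [← mul_div_assoc, div_le_iff₀ (by positivity)]; linarith
  have hb : l * ((n * L / 2 ^ r) ^ 2 * s) ≤ q ^ 2 := by
    calc _ ≤ s * ((n * L / 2 ^ r) ^ 2 * s) := by gcongr
      _ = q ^ 2 := by rw [hq]; ring
  -- The constants 64 and 28 leave `9Δ/20` for the square root and `Δ/28 ≤ Δ/20` for the
  -- second-order term.
  have hrad : 2 * l * ∑ i, gradUpper f δ X r i ^ 2 / (weightedPulls f δ X r i : ℝ) ≤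
      (9 / 20 * Δ) ^ 2 := by
    calc _ ≤ 2 * l * (2 * gradL1 f μ ^ 2 / (n * 2 ^ r) + 16 * (n * L / 2 ^ r) ^ 2 * s) := by
          gcongr
      _ = 4 * (gradL1 f μ ^ 2 * l / (n * 2 ^ r)) + 32 * (l * ((n * L / 2 ^ r) ^ 2 * s)) := by ring
      _ ≤ Δ ^ 2 / 16 + 32 * q ^ 2 := by linarith
      _ ≤ _ := by nlinarith
  have hsqrt := Real.sqrt_le_sqrt hrad
  rw [Real.sqrt_sq (by positivity)] at hsqrt
  have hsecond : L * n * s / cumUniformPulls n r ≤ q := by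
    rw [hq, mul_comm (n : ℝ)]
    have := two_pow_le_cumUniformPulls hn hr
    gcongr
  linarith

/-! ### Counting rounds and pulls -/

theorem log_round_le {x : ℝ} (hx : 2 ≤ x) {r : ℕ} (hr : 1 ≤ r) :
    Real.log (12 * x * (r : ℝ) ^ 2) ≤ 5 * Real.log x * (1 + Real.log r) := by
  have hr1 : (1 : ℝ) ≤ r := by exact_mod_cast hr
  have hlr : 0 ≤ Real.log r := Real.log_nonneg hr1
  have hx2 : Real.log 2 ≤ Real.log x := Real.log_le_log two_pos hx
  have h12 : Real.log 12 ≤ 4 * Real.log 2 := by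
    have : Real.log 12 ≤ Real.log (2 ^ 4) := Real.log_le_log (by norm_num) (by norm_num)
    rwa [Real.log_pow] at this
  have := Real.log_two_gt_d9
  rw [Real.log_mul (by positivity) (by positivity), Real.log_mul (by norm_num) (by positivity),
    Real.log_pow]
  push_cast
  nlinarith [mul_nonneg (sub_nonneg.2 hx2) hlr]

/-- If the stopping condition fails in round `r`, the budget of that round is still small. -/
theorem BoundsHold.budget_lt (h : BoundsHold f δ μ X r) (hf : Differentiable ℝ f)
    (hL : LipschitzWith L (gradient f)) (hn : 1 ≤ n) (hδ : 0 < δ) (hδ1 : δ < 1) (hr : 1 ≤ r)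
    {τ : ℝ} (hτ : f μ ≠ τ) (hSC : ¬ StopCondition f L τ δ X r) :
    (n * 2 ^ r : ℝ) < 320 * (gradL1 f μ ^ 2 * Real.log (2 / δ) / (f μ - τ) ^ 2 +
      (n : ℝ) ^ 2 * L * Real.log (2 * n / δ) / |f μ - τ|) * (1 + Real.log r) := by
  have hn1 : (1 : ℝ) ≤ n := by exact_mod_cast hn
  have hr1 : (1 : ℝ) ≤ r := by exact_mod_cast hr
  have hΔ : 0 < |f μ - τ| := abs_pos.2 (sub_ne_zero.2 hτ)
  have hlr : 0 ≤ Real.log r := Real.log_nonneg hr1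
  have hx1 : 2 ≤ 2 / δ := by rw [le_div_iff₀ hδ]; linarith
  have hx2 : 2 ≤ 2 * n / δ := by rw [le_div_iff₀ hδ]; nlinarith
  have hlog1 : 0 ≤ Real.log (2 / δ) := Real.log_nonneg (by linarith)
  have hlog2 : 0 ≤ Real.log (2 * n / δ) := Real.log_nonneg (by linarith)
  have hl := log_round_le hx1 hr
  have hs := log_round_le hx2 hr
  rw [show 12 * (2 / δ) * (r : ℝ) ^ 2 = 24 * (r : ℝ) ^ 2 / δ by ring] at hl
  rw [show 12 * (2 * n / δ) * (r : ℝ) ^ 2 = 24 * n * (r : ℝ) ^ 2 / δ by ring] at hs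
  rw [← sq_abs (f μ - τ)]
  set Δ := |f μ - τ|
  by_contra hcon
  rw [not_lt] at hcon
  have hA : 0 ≤ gradL1 f μ ^ 2 * Real.log (2 / δ) / Δ ^ 2 * (1 + Real.log r) := by positivity
  have hB : 0 ≤ (n : ℝ) ^ 2 * L * Real.log (2 * n / δ) / Δ * (1 + Real.log r) := by positivity
  -- Here `320 = 64 * 5`, the 5 coming from `log_round_le`; the second condition needs only `140 =
  -- 28 * 5`.
  have hw := h.funConfWidth_le hL hn hδ hδ1 hr hΔ (by
    calc 64 * gradL1 f μ ^ 2 * Real.log (24 * (r : ℝ) ^ 2 / δ)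
        ≤ 64 * gradL1 f μ ^ 2 * (5 * Real.log (2 / δ) * (1 + Real.log r)) := by gcongr
      _ = Δ ^ 2 * (320 * (gradL1 f μ ^ 2 * Real.log (2 / δ) / Δ ^ 2 * (1 + Real.log r))) := by
          field_simp; ring
      _ ≤ Δ ^ 2 * (n * 2 ^ r) := mul_le_mul_of_nonneg_left (by linarith) (by positivity)) (by
    have hn0 : (0 : ℝ) < n := by linarith
    refine le_of_mul_le_mul_left ?_ hn0
    calc n * (28 * (n * L * Real.log (24 * n * (r : ℝ) ^ 2 / δ)))
        ≤ n * (28 * (n * L * (5 * Real.log (2 * n / δ) * (1 + Real.log r)))) := by gcongr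
      _ = Δ * (140 * ((n : ℝ) ^ 2 * L * Real.log (2 * n / δ) / Δ * (1 + Real.log r))) := by
          field_simp; ring
      _ ≤ Δ * (n * 2 ^ r) := mul_le_mul_of_nonneg_left (by linarith) hΔ.le
      _ = n * (Δ * 2 ^ r) := by ring)
  have hdev := h.abs_sub_le_funConfWidth hf hL hδ hδ1 hr
  refine hSC ?_
  rw [StopCondition]
  have htri := abs_sub_le (f μ) (f (muTilde f δ X r)) τ
  rw [abs_sub_comm (f μ) (f (muTilde f δ X r))] at htri
  linarith

/-- Any polynomial bound would do, since it is used only inside a logarithm. The crude estimate `log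
x ≤ x` gives `2K⁵ + 2K⁶`, and `K ≥ 16` absorbs the constants. -/
theorem complexity_le_pow {n : ℕ} (hn : 1 ≤ n) {δ G L Δ : ℝ} (hδ : 0 < δ) (hδ1 : δ < 1)
    (hG : 0 ≤ G) (hL : 0 ≤ L) (hΔ : 0 < Δ) :
    G ^ 2 * Real.log (2 / δ) / Δ ^ 2 + (n : ℝ) ^ 2 * L * Real.log (2 * n / δ) / Δ ≤
      (16 + n + 1 / δ + G + L + 1 / Δ) ^ 7 := by
  have hn1 : (1 : ℝ) ≤ n := by exact_mod_cast hn
  have hdi : 0 < 1 / δ := by positivity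
  have hDi : 0 < 1 / Δ := by positivity
  obtain ⟨K, hK⟩ : ∃ K, K = 16 + n + 1 / δ + G + L + 1 / Δ := ⟨_, rfl⟩
  rw [← hK]
  have hK16 : 16 ≤ K := by linarith
  have hnK : n ≤ K := by linarith
  have hGK : G ≤ K := by linarith
  have hLK : L ≤ K := by linarith
  have hdK : 1 / δ ≤ K := by linarith
  have hDK : 1 / Δ ≤ K := by linarith
  have hl1 : Real.log (2 / δ) ≤ 2 * K := by
    refine (Real.log_le_self (by positivity)).trans ?_
    rw [show 2 / δ = 2 * (1 / δ) by ring]; linarith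
  have hl2 : Real.log (2 * n / δ) ≤ 2 * K ^ 2 := by
    refine (Real.log_le_self (by positivity)).trans ?_
    rw [show 2 * n / δ = 2 * (n * (1 / δ)) by ring, pow_two]
    gcongr
  have hl20 : 0 ≤ Real.log (2 * n / δ) := Real.log_nonneg ((one_le_div hδ).2 (by linarith))
  have hl10 : 0 ≤ Real.log (2 / δ) := Real.log_nonneg ((one_le_div hδ).2 (by linarith))
  have h1 : G ^ 2 * Real.log (2 / δ) / Δ ^ 2 ≤ 2 * K ^ 5 := by
    calc _ = G ^ 2 * Real.log (2 / δ) * (1 / Δ) ^ 2 := by ring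
      _ ≤ K ^ 2 * (2 * K) * K ^ 2 := by gcongr
      _ = _ := by ring
  have h2 : (n : ℝ) ^ 2 * L * Real.log (2 * n / δ) / Δ ≤ 2 * K ^ 6 := by
    calc _ = (n : ℝ) ^ 2 * L * Real.log (2 * n / δ) * (1 / Δ) := by ring
      _ ≤ K ^ 2 * K * (2 * K ^ 2) * K := by gcongr
      _ = _ := by ring
  have h5 : 0 < K ^ 5 := by positivity
  have h6 : K ^ 6 = K * K ^ 5 := by ring
  have h7 : K ^ 7 = K * K * K ^ 5 := by ring
  rw [h6] at h2
  rw [h7]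
  nlinarith [mul_le_mul_of_nonneg_right hK16 h5.le,
    mul_le_mul_of_nonneg_right hK16 (by positivity : 0 ≤ K * K ^ 5)]

/-- The constant 16 works because `log 16 = 4 log 2 > e`. This lets additive constants be absorbed
into the iterated logarithm. -/
theorem one_le_log_log {K : ℝ} (hK : 16 ≤ K) : 1 ≤ Real.log (Real.log K) := by
  have h1 : Real.log 16 ≤ Real.log K := Real.log_le_log (by norm_num) hK
  have h2 : Real.log 16 = 4 * Real.log 2 := by
    rw [show (16 : ℝ) = 2 ^ 4 by norm_num, Real.log_pow]; norm_num
  have := Real.log_two_gt_d9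
  have := Real.exp_one_lt_d9
  rw [Real.le_log_iff_exp_le (by linarith)]
  linarith

/-- A round index whose budget is at most `M (1 + log r)` with `M` polynomial in `K` is
logarithmic in `K`. -/
theorem round_le_of_budget_lt {n r : ℕ} (hn : 1 ≤ n) (hr : 1 ≤ r) {M K : ℝ} (hK : 16 ≤ K)
    (hM : M ≤ K ^ 7) (h : (n * 2 ^ r : ℝ) < 320 * M * (1 + Real.log r)) :
    (r : ℝ) ≤ 23 * Real.log K := by
  have hn1 : (1 : ℝ) ≤ n := by exact_mod_cast hn
  have hr1 : (1 : ℝ) ≤ r := by exact_mod_cast hr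
  have hlr : 0 ≤ Real.log r := Real.log_nonneg hr1
  have hlr' : Real.log r ≤ r - 1 := Real.log_le_sub_one_of_pos (by linarith)
  have h2K : 4 * Real.log 2 ≤ Real.log K := by
    have h1 : Real.log (2 ^ 4) ≤ Real.log K := Real.log_le_log (by norm_num) (by linarith)
    rwa [Real.log_pow] at h1
  have hl2 := Real.log_two_gt_d9
  have hl2' := Real.log_two_lt_d9
  have h320 : Real.log 320 ≤ 9 * Real.log 2 := by
    have h1 : Real.log 320 ≤ Real.log (2 ^ 9) := Real.log_le_log (by norm_num) (by norm_num)
    rwa [Real.log_pow] at h1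
  have hlt : (2 : ℝ) ^ r ≤ 320 * K ^ 7 * r := by
    calc (2 : ℝ) ^ r ≤ n * 2 ^ r := le_mul_of_one_le_left (by positivity) hn1
      _ ≤ 320 * M * (1 + Real.log r) := h.le
      _ ≤ 320 * K ^ 7 * r := by gcongr; linarith
  have hlog := Real.log_le_log (by positivity) hlt
  rw [Real.log_pow, Real.log_mul (by positivity) (by positivity),
    Real.log_mul (by norm_num) (by positivity), Real.log_pow] at hlog
  -- The tangent to `log` at 4: its slope `1/4` is below `log 2`, so `log r` can be absorbed into `r
  -- * log 2`.
  have htan : Real.log r ≤ r / 4 - 1 + 2 * Real.log 2 := by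
    have h1 := Real.log_le_sub_one_of_pos (show (0 : ℝ) < r / 4 by positivity)
    rw [Real.log_div (by positivity) (by norm_num), show (4 : ℝ) = 2 ^ 2 by norm_num,
      Real.log_pow] at h1
    norm_num at h1 ⊢
    linarith
  push_cast at hlog
  nlinarith

theorem one_add_log_round_le {r : ℕ} (hr : 1 ≤ r) {K : ℝ} (hK : 16 ≤ K)
    (h : (r : ℝ) ≤ 23 * Real.log K) : 1 + Real.log r ≤ 6 * Real.log (Real.log K) := by
  have hr1 : (1 : ℝ) ≤ r := by exact_mod_cast hr
  have hLL := one_le_log_log hK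
  have hpos : 0 < Real.log K := Real.log_pos (by linarith)
  have h1 := Real.log_le_log (by linarith) h
  rw [Real.log_mul (by norm_num) hpos.ne'] at h1
  have h23 : Real.log 23 ≤ 5 * Real.log 2 := by
    have h1 : Real.log 23 ≤ Real.log (2 ^ 5) := Real.log_le_log (by norm_num) (by norm_num)
    rwa [Real.log_pow] at h1
  have := Real.log_two_lt_d9
  linarith

/-- At a stop, `f(μ)` is no farther from `f(muTilde)` than `τ` is, so it cannot lie strictly beyond
`τ`; `hτ` rules out equality. -/
theorem BoundsHold.gt_iff_of_stopCondition (h : BoundsHold f δ μ X r) (hf : Differentiable ℝ f)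
    (hL : LipschitzWith L (gradient f)) (hδ : 0 < δ) (hδ1 : δ < 1) (hr : 1 ≤ r)
    {τ : ℝ} (hτ : f μ ≠ τ) (hSC : StopCondition f L τ δ X r) :
    f μ > τ ↔ f (muTilde f δ X r) > τ := by
  have hdev := (h.abs_sub_le_funConfWidth hf hL hδ hδ1 hr).trans hSC
  have h1 := abs_le.1 hdev
  constructor
  · intro hμ
    by_contra hcon
    rw [abs_of_nonpos (by linarith : f (muTilde f δ X r) - τ ≤ 0)] at h1
    linarith [h1.1]
  · intro hμ
    rw [abs_of_pos (by linarith : 0 < f (muTilde f δ X r) - τ)] at h1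
    exact lt_of_le_of_ne (by linarith [h1.2]) hτ.symm

/-- When all confidence bounds hold, the algorithm terminates with the correct answer within the
claimed number of pulls. -/
theorem exists_returns_of_boundsHold (h : ∀ r, 1 ≤ r → BoundsHold f δ μ X r)
    (hf : Differentiable ℝ f) (hL : LipschitzWith L (gradient f)) (hn : 1 ≤ n) (hδ : 0 < δ)
    (hδ1 : δ < 1) {τ : ℝ} (hτ : f μ ≠ τ) :
    ∃ (answer : Bool) (T : ℕ), Returns f L τ δ X answer T ∧ (answer = true ↔ f μ > τ) ∧
      (T : ℝ) ≤ 30720 * (n +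
        (gradL1 f μ ^ 2 * Real.log (2 / δ) / (f μ - τ) ^ 2 +
          (n : ℝ) ^ 2 * L * Real.log (2 * n / δ) / |f μ - τ|) *
        Real.log (Real.log (16 + n + 1 / δ + gradL1 f μ + L + 1 / |f μ - τ|))) := by
  classical
  have hn1 : (1 : ℝ) ≤ n := by exact_mod_cast hn
  have hΔ : 0 < |f μ - τ| := abs_pos.2 (sub_ne_zero.2 hτ)
  have hG : 0 ≤ gradL1 f μ := Finset.sum_nonneg fun i _ => abs_nonneg _
  set K := 16 + n + 1 / δ + gradL1 f μ + L + 1 / |f μ - τ| with hK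
  set M := gradL1 f μ ^ 2 * Real.log (2 / δ) / (f μ - τ) ^ 2 +
          (n : ℝ) ^ 2 * L * Real.log (2 * n / δ) / |f μ - τ| with hM
  have hK16 : 16 ≤ K := by
    have : 0 < 1 / δ := by positivity
    have : 0 < 1 / |f μ - τ| := by positivity
    linarith [NNReal.coe_nonneg L]
  have hMK : M ≤ K ^ 7 := by
    have := complexity_le_pow hn hδ hδ1 hG L.2 hΔ
    rwa [sq_abs] at this
  have hM0 : 0 ≤ M := by
    have h1 : 0 ≤ Real.log (2 / δ) := Real.log_nonneg ((one_le_div hδ).2 (by linarith))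
    have h2 : 0 ≤ Real.log (2 * n / δ) := Real.log_nonneg ((one_le_div hδ).2 (by linarith))
    positivity
  have hLL := one_le_log_log hK16
  have hround : ∀ r, 1 ≤ r → ¬ StopCondition f L τ δ X r →
      (r : ℝ) ≤ 23 * Real.log K ∧ (n * 2 ^ r : ℝ) ≤ 1920 * (M * Real.log (Real.log K)) := by
    intro r hr hSC
    have hb := (h r hr).budget_lt hf hL hn hδ hδ1 hr hτ hSC
    have hrK := round_le_of_budget_lt hn hr hK16 hMK hb
    refine ⟨hrK, hb.le.trans ?_⟩
    calc 320 * M * (1 + Real.log r) ≤ 320 * M * (6 * Real.log (Real.log K)) := by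
          gcongr; exact one_add_log_round_le hr hK16 hrK
      _ = _ := by ring
  have hex : ∃ r, 1 ≤ r ∧ StopCondition f L τ δ X r := by
    by_contra hcon
    push Not at hcon
    -- Rounds beyond `23 log K` cannot fail to stop, so the algorithm terminates.
    obtain ⟨r, hr⟩ := exists_nat_gt (23 * Real.log K)
    have h1 := (hround (r + 1) (by omega) (hcon _ (by omega))).1
    push_cast at h1
    linarith
  obtain ⟨hr, hSC⟩ := Nat.find_spec hex
  set r := Nat.find hex with hrdef
  have hmin : ∀ s, 1 ≤ s → s < r → ¬ StopCondition f L τ δ X s := fun s hs hsr hSC =>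
    Nat.find_min hex hsr ⟨hs, hSC⟩
  have hiff := (h r hr).gt_iff_of_stopCondition hf hL hδ hδ1 hr hτ hSC
  refine ⟨decide (f μ > τ), pullsThrough f δ X r,
    ⟨r, hr, hSC, hmin, by rw [decide_eq_true_iff, hiff], rfl⟩, decide_eq_true_iff, ?_⟩
  refine (pullsThrough_le hn).trans ?_
  have hMLL : 0 ≤ M * Real.log (Real.log K) := by positivity
  -- A stop in round 1 costs at most `16n`, which the term `n` pays for. Otherwise round `r - 1`
  -- failed, and doubling its budget gives `8 * 2 * 1920 = 30720`.
  rcases Nat.eq_or_lt_of_le hr with hr1 | hr1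
  · rw [← hr1]
    linarith
  · have hb := (hround (r - 1) (by omega) (hmin _ (by omega) (by omega))).2
    have hpow : (2 : ℝ) ^ r = 2 * 2 ^ (r - 1) := by
      rw [← pow_succ', Nat.sub_add_cancel hr]
    rw [hpow]
    linarith

end

end AdaptiveThresholding

open AdaptiveThresholding in
theorem theorem2 :
    ∃ C : ℝ, 0 < C ∧
      ∀ (n : ℕ), 1 ≤ n →
      ∀ (f : EuclideanSpace ℝ (Fin n) → ℝ) (L : NNReal),
        Differentiable ℝ f → LipschitzWith L (gradient f) →
      ∀ (μ : EuclideanSpace ℝ (Fin n)) (τ δ : ℝ), f μ ≠ τ → 0 < δ → δ < 1 →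
      ∀ (Ω : Type*) [MeasurableSpace Ω] (P : MeasureTheory.Measure Ω)
        [MeasureTheory.IsProbabilityMeasure P] (Z : Pull n → Ω → ℝ),
        (∀ a, ProbabilityTheory.HasLaw (Z a) (ProbabilityTheory.gaussianReal 0 1) P) →
        ProbabilityTheory.iIndepFun Z P →
        ENNReal.ofReal (1 - δ) ≤
          P {ω | ∃ (answer : Bool) (T : ℕ),
            Returns f L τ δ (fun a => μ a.1 + Z a ω) answer T ∧
            (answer = true ↔ f μ > τ) ∧
            (T : ℝ) ≤ C * (n +
              (gradL1 f μ ^ 2 * Real.log (2 / δ) / (f μ - τ) ^ 2 +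
                (n : ℝ) ^ 2 * L * Real.log (2 * n / δ) / |f μ - τ|) *
              Real.log (Real.log (16 + n + 1 / δ + gradL1 f μ + L + 1 / |f μ - τ|)))} := by
  refine ⟨30720, by norm_num, ?_⟩
  intro n hn f L hf hL μ τ δ hτ hδ hδ1 Ω _ P _ Z hZ hi
  refine (ofReal_one_sub_le_measure_boundsHold hZ hi hn hL.continuous μ hδ hδ1).trans
    (MeasureTheory.measure_mono fun ω hω => ?_)
  exact exists_returns_of_boundsHold hω hf hL hn hδ hδ1 hτ
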